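/- Let $f\in\mathbb{Z}[x,z]$ be a homogeneous polynomial of degree $5$ that is irreducible over $\mathbb{Q}$ (in particular, $f$ may be any homogeneous polynomial of degree $5$ that is irreducible in $\mathbb{Z}[x,z]$). For a positive integer $N$, let \[\delta(N) = \#\{(x,z)\in \mathbb{Z}^2 : |x|, |z|\leq N,\ \gcd(x,z)=1,\ p^2 \mid f(x,z) \text{ for some prime } p>N\}.\] Then for every $\epsilon>0$ there is a constant $C$, depending only on $f$ and $\epsilon$, such that \[\delta(N) \leq C\, N^{(5+\sqrt{113})/8 + \epsilon}\] for every integer $N\geq 1$. -/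

import Mathlib

/-- The coprime pairs of integers `(x, z)` with `|x|, |z| ≤ N` such that `p ^ 2 ∣ f(x, z)` for
some prime `p > N`. The two variables of `f` are indexed by `Fin 2`. -/
def largeSquareDivisorPairs (f : MvPolynomial (Fin 2) ℤ) (N : ℕ) : Set (ℤ × ℤ) :=
  {q | |q.1| ≤ (N : ℤ) ∧ |q.2| ≤ (N : ℤ) ∧ Int.gcd q.1 q.2 = 1 ∧
    ∃ p : ℕ, p.Prime ∧ N < p ∧ (p : ℤ) ^ 2 ∣ MvPolynomial.eval ![q.1, q.2] f}

/-- The set is finite, so its `Set.ncard` is its true cardinality. -/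
theorem largeSquareDivisorPairs_finite (f : MvPolynomial (Fin 2) ℤ) (N : ℕ) :
    (largeSquareDivisorPairs f N).Finite := by
  refine ((Set.finite_Icc (-(N : ℤ)) N).prod (Set.finite_Icc (-(N : ℤ)) N)).subset ?_
  rintro ⟨x, z⟩ ⟨hx, hz, -⟩
  exact ⟨abs_le.mp hx, abs_le.mp hz⟩

/-- The number `δ(N)` of such pairs. -/
noncomputable def largeSquareDivisorCount (f : MvPolynomial (Fin 2) ℤ) (N : ℕ) : ℕ :=
  (largeSquareDivisorPairs f N).ncard

/-!
A form `f` of odd degree `n` without rational zeros takes nonzero values `≪ N ^ n` at the nonzero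
points of the box `|x|, |z| ≤ N`. Fix a cut-off `L` for the primes `p > N` with `p ^ 2 ∣ f(x, z)`.

If `p ≤ L`, then `x / z` modulo `p` is one of boundedly many roots of `f`, which lift uniquely
modulo `p ^ 2`. Two primitive points above the same root have a determinant that is divisible by
`p ^ 2 > N ^ 2` and at most `2 N ^ 2` in size, so there are `O(1)` points for each prime, hence
`O(L)` in all.

If `p > L`, then `f(x, z) = d t ^ 2` with `d` squarefree and `|d| ≪ N ^ n / L ^ 2`, so `d f(x, z)`
is a square. Given `d`, the points with `d ∣ f(x, z)` lie on `O(d ^ ε)` lattices of determinant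
`|d|`, and on each lattice the square sieve with the odd primes up to `Q` counts those for which
`d f` is a square. As `n` is odd, replacing `(x, z)` by a non-square multiple changes the residue
symbol of `f(x, z)`, so complete sums of these symbols modulo `p q` cancel and the sieve gives
`O(N ^ 2 / (|d| Q) + Q ^ 2 N / ‖b‖)` up to factors `N ^ ε`, where `b` is a shortest vector of the
lattice. A vector `b` arises from few `d`, as `d ∣ f(b) ≠ 0`, and `‖b‖ ^ 2 ≪ |d|`; summing over `d`
gives `N ^ 2 / Q + Q ^ 2 N ^ (1 + n / 2) / L`.

Taking `Q = N ^ ((6 - n) / 8)` and `L = N ^ ((10 + n) / 8)` balances the three terms; for `n = 5`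
the exponent is `15 / 8 < (5 + √113) / 8`.
-/

open Polynomial

section BinaryForms

/-- The value `f(x, z)` of an integral binary polynomial at a point `w = (x, z)` of `R × R`. -/
noncomputable def formValue {R : Type*} [CommRing R] (f : MvPolynomial (Fin 2) ℤ) (w : R × R) :
    R :=
  MvPolynomial.aeval ![w.1, w.2] f

/-- The dehomogenization `f(X, 1)` of a binary polynomial, whose roots are the finite zeros of `f`
on the projective line. -/
noncomputable def dehomogenize {R : Type*} [CommRing R] (f : MvPolynomial (Fin 2) R) : R[X] :=
  MvPolynomial.aeval ![X, 1] f

/-- A binary form is anisotropic over `ℤ` (equivalently, over `ℚ`) if it vanishes at no nonzero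
integral point. -/
def IsAnisotropic (f : MvPolynomial (Fin 2) ℤ) : Prop :=
  ∀ w : ℤ × ℤ, w ≠ 0 → formValue f w ≠ 0

variable {R : Type*} [CommRing R] {n : ℕ}

theorem aeval_smul_of_isHomogeneous {σ A S : Type*} [CommSemiring A] [CommSemiring S] [Algebra A S]
    {f : MvPolynomial σ A} (hf : f.IsHomogeneous n) (t : S) (x : σ → S) :
    MvPolynomial.aeval (t • x) f = t ^ n * MvPolynomial.aeval x f := by
  rw [MvPolynomial.aeval_def, MvPolynomial.eval₂_eq, MvPolynomial.aeval_def, MvPolynomial.eval₂_eq,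
    Finset.mul_sum]
  refine Finset.sum_congr rfl fun d hd => ?_
  have hdeg : ∑ i ∈ d.support, d i = n := by
    have := hf (MvPolynomial.mem_support_iff.mp hd)
    simpa [Finsupp.weight_apply, Finsupp.sum] using this
  simp only [Pi.smul_apply, smul_eq_mul, mul_pow, Finset.prod_mul_distrib,
    Finset.prod_pow_eq_pow_sum, hdeg]
  ring

theorem not_isUnit_of_isHomogeneous {σ A : Type*} [CommSemiring A] [Nontrivial A]
    {f : MvPolynomial σ A} (hf : f.IsHomogeneous n) (hn : n ≠ 0) : ¬ IsUnit f := by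
  intro h
  have h0 := h.map (MvPolynomial.constantCoeff (R := A) (σ := σ))
  rw [MvPolynomial.constantCoeff_eq, hf.coeff_eq_zero (by simpa using hn.symm)] at h0
  exact not_isUnit_zero h0

theorem formValue_smul {f : MvPolynomial (Fin 2) ℤ} (hf : f.IsHomogeneous n) (t : R) (w : R × R) :
    formValue f (t • w) = t ^ n * formValue f w := by
  rw [formValue, formValue, ← aeval_smul_of_isHomogeneous hf]
  simp

theorem formValue_intCast (f : MvPolynomial (Fin 2) ℤ) (w : ℤ × ℤ) :
    formValue f ((w.1 : R), (w.2 : R)) = ((formValue f w : ℤ) : R) := by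
  have h := MvPolynomial.aeval_algebraMap_apply R ![w.1, w.2] f
  rw [eq_intCast] at h
  rw [formValue, formValue, ← h]
  congr 2
  ext i
  fin_cases i <;> simp

theorem homogenize_dehomogenize {f : MvPolynomial (Fin 2) R} (hf : f.IsHomogeneous n) :
    (dehomogenize f).homogenize n = f :=
  homogenize_eq_of_isHomogeneous hf rfl

theorem natDegree_dehomogenize_le {f : MvPolynomial (Fin 2) R} (hf : f.IsHomogeneous n) :
    (dehomogenize f).natDegree ≤ n := by
  rw [natDegree_le_iff_coeff_eq_zero]
  intro m hm
  rw [dehomogenize, MvPolynomial.aeval_def, MvPolynomial.eval₂_eq', finsetSum_coeff]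
  refine Finset.sum_eq_zero fun d hd => ?_
  have hdeg : d 0 + d 1 = n := by
    simpa [Finsupp.weight_apply, Finsupp.sum_fintype] using hf (MvPolynomial.mem_support_iff.mp hd)
  have hne : m ≠ d 0 := by omega
  simp [Fin.prod_univ_two, coeff_X_pow, hne]

theorem dehomogenize_map {S : Type*} [CommRing S] (φ : R →+* S) (f : MvPolynomial (Fin 2) R) :
    dehomogenize (MvPolynomial.map φ f) = (dehomogenize f).map φ := by
  rw [dehomogenize, dehomogenize, MvPolynomial.aeval_def, MvPolynomial.eval₂_map,
    ← coe_mapRingHom, MvPolynomial.aeval_def, MvPolynomial.hom_eval₂]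
  congr 1
  · ext; simp
  · ext i; fin_cases i <;> simp

theorem formValue_smul_one {f : MvPolynomial (Fin 2) ℤ} (hf : f.IsHomogeneous n) (r z : R) :
    formValue f (z * r, z) = z ^ n * aeval r (dehomogenize f) := by
  have h := formValue_smul hf z (r, 1)
  rw [Prod.smul_mk, smul_eq_mul, smul_eq_mul, mul_one] at h
  rw [h, formValue, ← homogenize_dehomogenize hf,
    aeval_homogenize_of_eq_one (natDegree_dehomogenize_le hf) _ (by simp),
    homogenize_dehomogenize hf]
  simp

theorem formValue_one_zero {f : MvPolynomial (Fin 2) ℤ} (hf : f.IsHomogeneous n) :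
    formValue f ((1, 0) : ℤ × ℤ) = (dehomogenize f).coeff n := by
  generalize hF : dehomogenize f = F
  rw [formValue, ← homogenize_dehomogenize hf, hF, homogenize, map_sum,
    Finset.sum_eq_single (n, 0)]
  · simp [MvPolynomial.aeval_monomial, Finsupp.prod_fintype]
  · rintro ⟨i, j⟩ hij hne
    have hj : j ≠ 0 := by
      rintro rfl
      simp_all
    simp [MvPolynomial.aeval_monomial, Finsupp.prod_fintype, hj]
  · simp

theorem exists_abs_formValue_le {f : MvPolynomial (Fin 2) ℤ} (hf : f.IsHomogeneous n) :
    ∃ H : ℝ, 1 ≤ H ∧ ∀ (w : ℤ × ℤ) (T : ℝ), |(w.1 : ℝ)| ≤ T → |(w.2 : ℝ)| ≤ T →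
      |((formValue f w : ℤ) : ℝ)| ≤ H * T ^ n := by
  refine ⟨1 + ∑ d ∈ f.support, |((f.coeff d : ℤ) : ℝ)|,
    le_add_of_nonneg_right (by positivity), fun w T h₁ h₂ => ?_⟩
  have hT : 0 ≤ T := (abs_nonneg _).trans h₁
  have hterm : ∀ d ∈ f.support,
      |((f.coeff d : ℤ) : ℝ) * ((w.1 : ℝ) ^ d 0 * (w.2 : ℝ) ^ d 1)| ≤
        |((f.coeff d : ℤ) : ℝ)| * T ^ n := by
    intro d hd
    have hdeg : d 0 + d 1 = n := by
      simpa [Finsupp.weight_apply, Finsupp.sum_fintype] using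
        hf (MvPolynomial.mem_support_iff.mp hd)
    rw [abs_mul, abs_mul, abs_pow, abs_pow, ← hdeg, pow_add]
    gcongr
  have hvalue : ((formValue f w : ℤ) : ℝ) =
      ∑ d ∈ f.support, ((f.coeff d : ℤ) : ℝ) * ((w.1 : ℝ) ^ d 0 * (w.2 : ℝ) ^ d 1) := by
    rw [← formValue_intCast, formValue, MvPolynomial.aeval_def, MvPolynomial.eval₂_eq']
    simp [Fin.prod_univ_two]
  rw [hvalue, add_mul, one_mul, Finset.sum_mul]
  exact (Finset.abs_sum_le_sum_abs _ _).trans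
    ((Finset.sum_le_sum hterm).trans (le_add_of_nonneg_left (by positivity)))

theorem IsAnisotropic.ne_zero {f : MvPolynomial (Fin 2) ℤ} (hf0 : IsAnisotropic f) : f ≠ 0 := by
  rintro rfl
  exact hf0 (1, 0) (by simp) (by simp [formValue])

end BinaryForms

section FactorsOfForms

variable {n : ℕ}

theorem natDegree_dehomogenize {f : MvPolynomial (Fin 2) ℤ} (hf : f.IsHomogeneous n)
    (hf0 : IsAnisotropic f) : (dehomogenize f).natDegree = n := by
  refine natDegree_eq_of_le_of_coeff_ne_zero (natDegree_dehomogenize_le hf) ?_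
  rw [← formValue_one_zero hf]
  exact hf0 _ (by simp)

theorem eq_zero_or_eq_zero_of_irreducible_homogenize_mul {K : Type*} [Field K] {G H : K[X]}
    {a b : ℕ} (hG : G.natDegree ≤ a) (hH : H.natDegree ≤ b)
    (h : Irreducible ((G * H).homogenize (a + b))) : a = 0 ∨ b = 0 := by
  by_contra! hab
  rcases h.isUnit_or_isUnit (homogenize_mul G H hG hH) with hu | hu
  · exact not_isUnit_of_isHomogeneous (isHomogeneous_homogenize G) hab.1 hu
  · exact not_isUnit_of_isHomogeneous (isHomogeneous_homogenize H) hab.2 hu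

theorem isAnisotropic_of_irreducible {f : MvPolynomial (Fin 2) ℤ} (hf : f.IsHomogeneous n)
    (hn : 2 ≤ n) (hirr : Irreducible (MvPolynomial.map (Int.castRingHom ℚ) f)) :
    IsAnisotropic f := by
  rintro ⟨x, z⟩ hw h0
  obtain ⟨n, rfl⟩ := Nat.exists_eq_add_of_le' (show 1 ≤ n by omega)
  set F := dehomogenize (MvPolynomial.map (Int.castRingHom ℚ) f) with hF
  have hFdeg : F.natDegree ≤ n + 1 := natDegree_dehomogenize_le (hf.map _)
  rw [← homogenize_dehomogenize (hf.map (Int.castRingHom ℚ)), ← hF] at hirr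
  rcases eq_or_ne z 0 with rfl | hz
  · have hx : x ≠ 0 := by rintro rfl; exact hw rfl
    have hcoeff : (dehomogenize f).coeff (n + 1) = 0 := by
      have h := formValue_smul hf x (1, 0)
      rw [Prod.smul_mk, smul_eq_mul, smul_eq_mul, mul_one, mul_zero, h0,
        formValue_one_zero hf] at h
      simpa [hx] using h.symm
    have hlt : F.natDegree ≤ n := by
      refine Nat.lt_succ_iff.mp (lt_of_le_of_ne hFdeg fun h => ?_)
      have hlead : F.coeff (n + 1) = 0 := by rw [hF, dehomogenize_map]; simp [hcoeff]
      rw [← Nat.succ_eq_add_one, ← h, coeff_natDegree, leadingCoeff_eq_zero] at hlead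
      simp [hlead] at h
    rw [← mul_one F] at hirr
    have := eq_zero_or_eq_zero_of_irreducible_homogenize_mul hlt (by simp) hirr
    omega
  · have hz' : (z : ℚ) ≠ 0 := by exact_mod_cast hz
    have hroot : F.IsRoot (x / z : ℚ) := by
      have h := formValue_smul_one hf (x / z : ℚ) (z : ℚ)
      rw [mul_div_cancel₀ _ hz', formValue_intCast f (x, z), h0] at h
      simpa [hF, dehomogenize_map, aeval_def, eval_map, hz'] using h.symm
    obtain ⟨G, hG⟩ := dvd_iff_isRoot.mpr hroot
    have hGdeg : G.natDegree ≤ n := by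
      rcases eq_or_ne G 0 with rfl | hG0
      · simp
      · rw [hG, natDegree_mul (X_sub_C_ne_zero _) hG0, natDegree_X_sub_C] at hFdeg
        omega
    rw [hG, add_comm n 1] at hirr
    have := eq_zero_or_eq_zero_of_irreducible_homogenize_mul (by simp) hGdeg hirr
    omega

theorem squarefree_of_squarefree_homogenize {K : Type*} [Field K] {F : K[X]}
    (hF : F.natDegree ≤ n) (h : Squarefree (F.homogenize n)) : Squarefree F := by
  rintro G ⟨H, rfl⟩
  have hne : G * G * H ≠ 0 := by
    intro h0
    rw [h0, homogenize_zero] at h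
    exact not_squarefree_zero h
  have hdeg : (G * G * H).natDegree = G.natDegree + G.natDegree + H.natDegree := by
    rw [natDegree_mul (left_ne_zero_of_mul hne) (right_ne_zero_of_mul hne),
      natDegree_mul (by aesop) (by aesop)]
  have hdvd : G.homogenize G.natDegree * G.homogenize G.natDegree ∣ (G * G * H).homogenize n := by
    obtain ⟨m, rfl⟩ := Nat.exists_eq_add_of_le (show G.natDegree + G.natDegree ≤ n by omega)
    rw [homogenize_mul (G * G) H natDegree_mul_le (by omega), homogenize_mul G G le_rfl le_rfl]
    exact dvd_mul_right _ _
  have hG : G.natDegree = 0 := by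
    by_contra hG
    exact not_isUnit_of_isHomogeneous (isHomogeneous_homogenize G) hG (h _ hdvd)
  rw [isUnit_iff_degree_eq_zero, degree_eq_natDegree (by aesop), hG, Nat.cast_zero]

theorem exists_bezout_derivative {f : MvPolynomial (Fin 2) ℤ} (hf : f.IsHomogeneous n)
    (hn : n ≠ 0) (hf0 : IsAnisotropic f)
    (hsq : Squarefree (MvPolynomial.map (Int.castRingHom ℚ) f)) :
    ∃ D : ℤ, D ≠ 0 ∧ ∃ A B : ℤ[X],
      dehomogenize f * A + derivative (dehomogenize f) * B = C D := by
  set F := dehomogenize f with hF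
  have hinj := RingHom.injective_int (Int.castRingHom ℚ)
  obtain ⟨A, B, -, -, h⟩ := exists_mul_add_mul_eq_C_resultant F (derivative F) le_rfl le_rfl
    (.inl (by rwa [hF, natDegree_dehomogenize hf hf0]))
  refine ⟨_, fun h0 => ?_, A, B, h⟩
  have hsep : (F.map (Int.castRingHom ℚ)).Separable := by
    rw [← homogenize_dehomogenize (hf.map _)] at hsq
    rw [PerfectField.separable_iff_squarefree, hF, ← dehomogenize_map]
    exact squarefree_of_squarefree_homogenize (natDegree_dehomogenize_le (hf.map _)) hsq
  refine resultant_ne_zero _ _ hsep ?_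
  rw [derivative_map, natDegree_map_eq_of_injective hinj, natDegree_map_eq_of_injective hinj,
    resultant_map_map, h0, map_zero]

end FactorsOfForms

section ProjectiveClasses

/-- The determinant of two integer vectors. -/
def cross (w w' : ℤ × ℤ) : ℤ := w.1 * w'.2 - w.2 * w'.1

/-- The point `x / z` of the projective line over `ZMod p` given by `(x, z)`;
the value `none` stands for infinity. -/
def projClass (p : ℕ) (w : ℤ × ℤ) : Option (ZMod p) :=
  if (w.2 : ZMod p) = 0 then none else some ((w.1 : ZMod p) * (w.2 : ZMod p)⁻¹)

theorem dvd_cross_of_projClass_eq {p : ℕ} [Fact p.Prime] {w w' : ℤ × ℤ}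
    (h : projClass p w = projClass p w') : (p : ℤ) ∣ cross w w' := by
  rw [← ZMod.intCast_zmod_eq_zero_iff_dvd _ p, cross, Int.cast_sub, Int.cast_mul, Int.cast_mul]
  unfold projClass at h
  split_ifs at h with hz hz' hz'
  · simp [hz, hz']
  · rw [← div_eq_mul_inv, ← div_eq_mul_inv] at h
    linear_combination (div_eq_div_iff hz hz').mp (Option.some.inj h)

theorem projClass_mem_insertNone_roots {n : ℕ} {f : MvPolynomial (Fin 2) ℤ}
    (hf : f.IsHomogeneous n) {p : ℕ} [Fact p.Prime]
    (hp : (dehomogenize f).map (Int.castRingHom (ZMod p)) ≠ 0) {w : ℤ × ℤ}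
    (hw : (p : ℤ) ∣ formValue f w) :
    projClass p w ∈ Finset.insertNone
      ((dehomogenize f).map (Int.castRingHom (ZMod p))).roots.toFinset := by
  unfold projClass
  split_ifs with hz
  · exact Finset.none_mem_insertNone
  · have hvalue := formValue_smul_one hf (w.1 / w.2 : ZMod p) (w.2 : ZMod p)
    rw [mul_div_cancel₀ _ hz, formValue_intCast f w,
      (ZMod.intCast_zmod_eq_zero_iff_dvd _ p).mpr hw] at hvalue
    rw [← div_eq_mul_inv, Finset.some_mem_insertNone, Multiset.mem_toFinset, mem_roots hp,
      IsRoot, eval_map]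
    simpa [aeval_def, hz] using hvalue.symm

theorem exists_card_image_projClass_le {n : ℕ} {f : MvPolynomial (Fin 2) ℤ}
    (hf : f.IsHomogeneous n) (hf0 : f ≠ 0) :
    ∃ K : ℕ, 1 ≤ K ∧ ∀ p : ℕ, p.Prime → ∀ S : Finset (ℤ × ℤ),
      (∀ w ∈ S, (p : ℤ) ∣ formValue f w) → (S.image (projClass p)).card ≤ K := by
  set F := dehomogenize f with hF
  have hF0 : F ≠ 0 := by
    intro h
    exact hf0 (by rw [← homogenize_dehomogenize hf, ← hF, h, homogenize_zero])
  refine ⟨F.leadingCoeff.natAbs + n + 1, by omega, fun p hp S hS => ?_⟩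
  have := Fact.mk hp
  by_cases hlead : (p : ℤ) ∣ F.leadingCoeff
  · have hple : p ≤ F.leadingCoeff.natAbs :=
      Nat.le_of_dvd (Int.natAbs_pos.mpr (leadingCoeff_ne_zero.mpr hF0)) (Int.natCast_dvd.mp hlead)
    calc (S.image (projClass p)).card ≤ Fintype.card (Option (ZMod p)) := Finset.card_le_univ _
      _ = p + 1 := by rw [Fintype.card_option, ZMod.card]
      _ ≤ F.leadingCoeff.natAbs + n + 1 := by omega
  · set G := F.map (Int.castRingHom (ZMod p)) with hG
    have hG0 : G ≠ 0 := by
      intro h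
      have hcoeff : G.coeff F.natDegree = 0 := by rw [h, coeff_zero]
      rw [hG, coeff_map, coeff_natDegree, eq_intCast,
        ZMod.intCast_zmod_eq_zero_iff_dvd] at hcoeff
      exact hlead hcoeff
    calc (S.image (projClass p)).card
        ≤ (Finset.insertNone G.roots.toFinset).card := by
          refine Finset.card_le_card (Finset.image_subset_iff.mpr fun w hw => ?_)
          exact projClass_mem_insertNone_roots hf hG0 (hS w hw)
      _ = G.roots.toFinset.card + 1 := Finset.card_insertNone _
      _ ≤ n + 1 := by
          gcongr
          exact (G.roots.toFinset_card_le.trans G.card_roots').trans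
            (natDegree_map_le.trans (natDegree_dehomogenize_le hf))
      _ ≤ F.leadingCoeff.natAbs + n + 1 := by omega

theorem dvd_cross_of_forall_projClass_eq {d : ℤ} (hd : Squarefree d) {w w' : ℤ × ℤ}
    (h : ∀ p ∈ d.natAbs.primeFactors, projClass p w = projClass p w') : d ∣ cross w w' := by
  rw [← Int.natAbs_dvd_natAbs,
    ← Nat.prod_primeFactors_of_squarefree (Int.squarefree_natAbs.mpr hd)]
  refine Finset.prod_primes_dvd _ (fun p hp => (Nat.prime_of_mem_primeFactors hp).prime)
    fun p hp => ?_
  have := Fact.mk (Nat.prime_of_mem_primeFactors hp)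
  exact Int.natCast_dvd.mp (dvd_cross_of_projClass_eq (h p hp))

theorem exists_card_le_pow_mul_card_filter_dvd_cross {f : MvPolynomial (Fin 2) ℤ} {K : ℕ}
    {d : ℤ} (hd : Squarefree d) {S : Finset (ℤ × ℤ)} (hne : S.Nonempty)
    (hS : ∀ w ∈ S, d ∣ formValue f w)
    (hK : ∀ p : ℕ, p.Prime → ∀ S : Finset (ℤ × ℤ), (∀ w ∈ S, (p : ℤ) ∣ formValue f w) →
      (S.image (projClass p)).card ≤ K) :
    ∃ w₀ ∈ S, S.card ≤ K ^ d.natAbs.primeFactors.card * {w ∈ S | d ∣ cross w w₀}.card := by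
  let classes : ℤ × ℤ → ∀ p ∈ d.natAbs.primeFactors, Option (ZMod p) := fun w p _ => projClass p w
  obtain ⟨w₀, hw₀, hmax⟩ := S.exists_max_image (fun v => {w ∈ S | d ∣ cross w v}.card) hne
  refine ⟨w₀, hw₀, ?_⟩
  have hfiber : ∀ c ∈ S.image classes,
      {w ∈ S | classes w = c}.card ≤ {w ∈ S | d ∣ cross w w₀}.card := by
    intro c hc
    obtain ⟨v, hv, rfl⟩ := Finset.mem_image.mp hc
    refine le_trans (Finset.card_le_card fun w hw => ?_) (hmax v hv)
    rw [Finset.mem_filter] at hw ⊢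
    exact ⟨hw.1, dvd_cross_of_forall_projClass_eq hd fun p hp => congrFun (congrFun hw.2 p) hp⟩
  have hclasses : (S.image classes).card ≤ K ^ d.natAbs.primeFactors.card := by
    calc (S.image classes).card
        ≤ (d.natAbs.primeFactors.pi fun p => S.image (projClass p)).card := by
          refine Finset.card_le_card (Finset.image_subset_iff.mpr fun w hw => ?_)
          exact Finset.mem_pi.mpr fun p _ => Finset.mem_image_of_mem _ hw
      _ = ∏ p ∈ d.natAbs.primeFactors, (S.image (projClass p)).card := Finset.card_pi _ _
      _ ≤ K ^ d.natAbs.primeFactors.card := by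
          refine Finset.prod_le_pow_card _ _ _ fun p hp => ?_
          exact hK p (Nat.prime_of_mem_primeFactors hp) S fun w hw =>
            (Int.natCast_dvd.mpr (Nat.dvd_of_mem_primeFactors hp)).trans (hS w hw)
  calc S.card ≤ {w ∈ S | d ∣ cross w w₀}.card * (S.image classes).card :=
        Finset.card_le_mul_card_image S _ hfiber
    _ ≤ K ^ d.natAbs.primeFactors.card * {w ∈ S | d ∣ cross w w₀}.card := by
        rw [mul_comm]
        gcongr

end ProjectiveClasses

section CoprimeBox

/-- The primitive integral points `(x, z)` with `|x|, |z| ≤ N`. -/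
noncomputable def coprimeBox (N : ℕ) : Finset (ℤ × ℤ) :=
  {w ∈ Finset.Icc (-(N : ℤ)) N ×ˢ Finset.Icc (-(N : ℤ)) N | IsCoprime w.1 w.2}

theorem mem_coprimeBox {N : ℕ} {w : ℤ × ℤ} :
    w ∈ coprimeBox N ↔ |w.1| ≤ N ∧ |w.2| ≤ N ∧ IsCoprime w.1 w.2 := by
  simp [coprimeBox, abs_le, and_assoc]

theorem card_coprimeBox_le (N : ℕ) : (coprimeBox N).card ≤ (2 * N + 1) ^ 2 := by
  refine (Finset.card_filter_le _ _).trans_eq ?_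
  rw [Finset.card_product, Int.card_Icc, sq, show (N + 1 - -(N : ℤ)).toNat = 2 * N + 1 by omega]

theorem ne_zero_of_isCoprime {w : ℤ × ℤ} (hw : IsCoprime w.1 w.2) : w ≠ 0 := by
  rintro rfl
  exact not_isCoprime_zero_zero hw

theorem exists_abs_formValue_le_on_coprimeBox {n : ℕ} {f : MvPolynomial (Fin 2) ℤ}
    (hf : f.IsHomogeneous n) :
    ∃ H : ℝ, 1 ≤ H ∧ ∀ N : ℕ, ∀ w ∈ coprimeBox N, |((formValue f w : ℤ) : ℝ)| ≤ H * N ^ n := by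
  obtain ⟨H, hH1, hH⟩ := exists_abs_formValue_le hf
  refine ⟨H, hH1, fun N w hw => ?_⟩
  obtain ⟨h₁, h₂, -⟩ := mem_coprimeBox.mp hw
  exact hH w N (by exact_mod_cast h₁) (by exact_mod_cast h₂)

theorem eq_or_eq_neg_of_cross_eq_zero {w w' : ℤ × ℤ} (hw : IsCoprime w.1 w.2)
    (hw' : IsCoprime w'.1 w'.2) (h : cross w w' = 0) : w' = w ∨ w' = -w := by
  obtain ⟨x, z⟩ := w
  obtain ⟨x', z'⟩ := w'
  simp only [cross] at *
  have h₁ : Associated x x' := associated_of_dvd_dvd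
    (hw.dvd_of_dvd_mul_left ⟨z', by linarith⟩) (hw'.dvd_of_dvd_mul_right ⟨z, by linarith⟩)
  have h₂ : Associated z z' := associated_of_dvd_dvd
    (hw.symm.dvd_of_dvd_mul_right ⟨x', by linarith⟩) (hw'.symm.dvd_of_dvd_mul_left ⟨x, by linarith⟩)
  simp only [Prod.neg_mk, Prod.mk.injEq]
  rcases Int.associated_iff.mp h₁ with rfl | rfl <;>
    rcases Int.associated_iff.mp h₂ with rfl | rfl
  · simp
  · rcases mul_eq_zero.mp (show x * z' = 0 by linarith) with rfl | rfl <;> simp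
  · rcases mul_eq_zero.mp (show x' * z = 0 by linarith) with rfl | rfl <;> simp
  · simp

theorem eq_of_cross_eq_cross {w₁ w₂ v v' : ℤ × ℤ} (h : cross w₁ w₂ ≠ 0)
    (h₁ : cross v w₁ = cross v' w₁) (h₂ : cross v w₂ = cross v' w₂) : v = v' := by
  unfold cross at *
  have hx : (v.1 - v'.1) * (w₁.1 * w₂.2 - w₁.2 * w₂.1) = 0 := by
    linear_combination w₁.1 * h₂ - w₂.1 * h₁
  have hz : (v.2 - v'.2) * (w₁.1 * w₂.2 - w₁.2 * w₂.1) = 0 := by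
    linear_combination w₁.2 * h₂ - w₂.2 * h₁
  exact Prod.ext (sub_eq_zero.mp ((mul_eq_zero.mp hx).resolve_right h))
    (sub_eq_zero.mp ((mul_eq_zero.mp hz).resolve_right h))

theorem abs_cross_le_of_mem_coprimeBox {N : ℕ} {w w' : ℤ × ℤ} (hw : w ∈ coprimeBox N)
    (hw' : w' ∈ coprimeBox N) : |cross w w'| ≤ 2 * N ^ 2 := by
  obtain ⟨h₁, h₂, -⟩ := mem_coprimeBox.mp hw
  obtain ⟨h₁', h₂', -⟩ := mem_coprimeBox.mp hw'
  calc |cross w w'| ≤ |w.1| * |w'.2| + |w.2| * |w'.1| := by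
        rw [cross, ← abs_mul, ← abs_mul]
        exact abs_sub _ _
    _ ≤ N * N + N * N := by gcongr
    _ = 2 * N ^ 2 := by ring

theorem card_le_nine_of_dvd_cross {m : ℤ} {N : ℕ} (hNm : (N : ℤ) ^ 2 < m) {S : Finset (ℤ × ℤ)}
    (hS : S ⊆ coprimeBox N) (hdvd : ∀ w ∈ S, ∀ w' ∈ S, m ∣ cross w w') : S.card ≤ 9 := by
  have hm : 0 < m := (sq_nonneg _).trans_lt hNm
  have hvalues : ∀ w ∈ S, ∀ w' ∈ S, cross w w' ∈ ({0, m, -m} : Finset ℤ) := by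
    intro w hw w' hw'
    obtain ⟨k, hk⟩ := hdvd w hw w' hw'
    have hbound := abs_cross_le_of_mem_coprimeBox (hS hw) (hS hw')
    rw [hk, abs_mul, abs_of_pos hm] at hbound
    have hk2 : |k| < 2 := by nlinarith
    rw [abs_lt] at hk2
    obtain rfl | rfl | rfl : k = 0 ∨ k = 1 ∨ k = -1 := by omega
    all_goals simp [hk]
  have hcop : ∀ w ∈ S, IsCoprime w.1 w.2 := fun w hw => (mem_coprimeBox.mp (hS hw)).2.2
  by_cases hall : ∀ w ∈ S, ∀ w' ∈ S, cross w w' = 0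
  · rcases S.eq_empty_or_nonempty with rfl | ⟨w, hw⟩
    · simp
    · have hpm : S ⊆ {w, -w} := fun w' hw' => by
        simpa using eq_or_eq_neg_of_cross_eq_zero (hcop w hw) (hcop w' hw') (hall w hw w' hw')
      exact (Finset.card_le_card hpm).trans (Finset.card_le_two.trans (by norm_num))
  · push Not at hall
    obtain ⟨w₁, hw₁, w₂, hw₂, hne⟩ := hall
    have hpairs : S.card ≤ (({0, m, -m} : Finset ℤ) ×ˢ ({0, m, -m} : Finset ℤ)).card := by
      refine Finset.card_le_card_of_injOn (fun v => (cross v w₁, cross v w₂)) (fun v hv => ?_)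
        fun v _ v' _ h => eq_of_cross_eq_cross hne (Prod.ext_iff.mp h).1 (Prod.ext_iff.mp h).2
      exact Finset.mem_product.mpr ⟨hvalues v hv w₁ hw₁, hvalues v hv w₂ hw₂⟩
    rw [Finset.card_product] at hpairs
    exact hpairs.trans (Nat.mul_le_mul Finset.card_le_three Finset.card_le_three)

end CoprimeBox

section Hensel

variable {n p k : ℕ} {f : MvPolynomial (Fin 2) ℤ}

theorem isUnit_intCast_zmod_pow (hp : p.Prime) {a : ℤ} (ha : ¬ (p : ℤ) ∣ a) :
    IsUnit (a : ZMod (p ^ k)) := by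
  rw [ZMod.coe_int_isUnit_iff_isCoprime, Nat.cast_pow]
  exact (((Nat.prime_iff_prime_int.mp hp).coprime_iff_not_dvd).mpr ha).pow_left

theorem isNilpotent_intCast_zmod_pow {a : ℤ} (ha : (p : ℤ) ∣ a) :
    IsNilpotent (a : ZMod (p ^ k)) := by
  refine ⟨k, ?_⟩
  rw [← Int.cast_pow, ZMod.intCast_zmod_eq_zero_iff_dvd, Nat.cast_pow]
  exact pow_dvd_pow_of_dvd ha k

theorem not_dvd_snd_of_dvd_formValue (hf : f.IsHomogeneous n) (hp : p.Prime)
    (hlead : ¬ (p : ℤ) ∣ (dehomogenize f).coeff n) {w : ℤ × ℤ} (hw : IsCoprime w.1 w.2)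
    (h : (p : ℤ) ∣ formValue f w) : ¬ (p : ℤ) ∣ w.2 := by
  intro hz
  have hpp : Prime (p : ℤ) := Nat.prime_iff_prime_int.mp hp
  have hx : ¬ (p : ℤ) ∣ w.1 := fun hx => hpp.not_isUnit (hw.isUnit_of_dvd' hx hz)
  have hvalue : ((formValue f w : ℤ) : ZMod p) = ((w.1 ^ n * (dehomogenize f).coeff n : ℤ)) := by
    have hsmul := formValue_smul hf (w.1 : ZMod p) (1, 0)
    have hone : formValue f ((1, 0) : ZMod p × ZMod p) = ((dehomogenize f).coeff n : ℤ) := by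
      rw [← formValue_one_zero hf, ← formValue_intCast]
      simp
    rw [← formValue_intCast, (ZMod.intCast_zmod_eq_zero_iff_dvd _ p).mpr hz]
    simpa [hone] using hsmul
  rw [(ZMod.intCast_zmod_eq_zero_iff_dvd _ p).mpr h, eq_comm,
    ZMod.intCast_zmod_eq_zero_iff_dvd] at hvalue
  rcases hpp.dvd_or_dvd hvalue with hdvd | hdvd
  · exact hx (hpp.dvd_of_dvd_pow hdvd)
  · exact hlead hdvd

/-- Uniqueness in Hensel's lemma, applied to the roots `x / z` of `f(X, 1)` modulo `p ^ k`. -/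
theorem pow_dvd_cross_of_dvd_cross (hf : f.IsHomogeneous n) {D : ℤ} {A B : ℤ[X]}
    (hD : dehomogenize f * A + derivative (dehomogenize f) * B = C D) (hp : p.Prime)
    (hpD : ¬ (p : ℤ) ∣ D) {w w' : ℤ × ℤ} (hz : ¬ (p : ℤ) ∣ w.2) (hz' : ¬ (p : ℤ) ∣ w'.2)
    (h : (p : ℤ) ^ k ∣ formValue f w) (h' : (p : ℤ) ^ k ∣ formValue f w')
    (hc : (p : ℤ) ∣ cross w w') : (p : ℤ) ^ k ∣ cross w w' := by
  set F := dehomogenize f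
  have hroot : ∀ v : ℤ × ℤ, ¬ (p : ℤ) ∣ v.2 → (p : ℤ) ^ k ∣ formValue f v →
      ∃ r : ZMod (p ^ k), (v.2 : ZMod (p ^ k)) * r = v.1 ∧ aeval r F = 0 := by
    intro v hv hvdvd
    have hu : IsUnit (v.2 : ZMod (p ^ k)) := isUnit_intCast_zmod_pow hp hv
    obtain ⟨r, hr⟩ := hu.dvd (a := (v.1 : ZMod (p ^ k)))
    have hvalue := formValue_smul_one hf r (v.2 : ZMod (p ^ k))
    rw [← hr, formValue_intCast, (ZMod.intCast_zmod_eq_zero_iff_dvd _ _).mpr (by simpa)] at hvalue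
    exact ⟨r, hr.symm, ((hu.pow n).mul_right_eq_zero).mp hvalue.symm⟩
  obtain ⟨r, hr, hFr⟩ := hroot w hz h
  obtain ⟨r', hr', hFr'⟩ := hroot w' hz' h'
  have hcross : ((cross w w' : ℤ) : ZMod (p ^ k)) = (w.2 : ZMod (p ^ k)) * w'.2 * (r - r') := by
    simp only [cross, Int.cast_sub, Int.cast_mul, ← hr, ← hr']
    ring
  have hnil : IsNilpotent (r - r') := by
    have hu := (isUnit_intCast_zmod_pow (k := k) hp hz).mul (isUnit_intCast_zmod_pow hp hz')
    exact (hu.isNilpotent_unit_mul_of_commute_iff (Commute.all _ _)).mp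
      (hcross ▸ isNilpotent_intCast_zmod_pow hc)
  have hsimple : IsUnit (aeval r (derivative F)) := by
    have hDr := congrArg (aeval r) hD
    rw [map_add, map_mul, map_mul, hFr, zero_mul, zero_add, aeval_C, eq_intCast] at hDr
    exact isUnit_of_mul_isUnit_left (hDr ▸ isUnit_intCast_zmod_pow hp hpD)
  have hrr' : r = r' :=
    (existsUnique_nilpotent_sub_and_aeval_eq_zero (by simp [hFr]) hsimple).unique
      ⟨by simp, hFr⟩ ⟨hnil, hFr'⟩
  rw [hrr', sub_self, mul_zero, ZMod.intCast_zmod_eq_zero_iff_dvd, Nat.cast_pow] at hcross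
  exact hcross

theorem card_filter_sq_dvd_formValue_le (hf : f.IsHomogeneous n) {D : ℤ} {A B : ℤ[X]}
    (hD : dehomogenize f * A + derivative (dehomogenize f) * B = C D) (hp : p.Prime)
    (hpD : ¬ (p : ℤ) ∣ D) (hlead : ¬ (p : ℤ) ∣ (dehomogenize f).coeff n) {N K : ℕ} (hNp : N < p)
    (hK : ∀ S : Finset (ℤ × ℤ), (∀ w ∈ S, (p : ℤ) ∣ formValue f w) →
      (S.image (projClass p)).card ≤ K) :
    {w ∈ coprimeBox N | (p : ℤ) ^ 2 ∣ formValue f w}.card ≤ 9 * K := by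
  have := Fact.mk hp
  set S := {w ∈ coprimeBox N | (p : ℤ) ^ 2 ∣ formValue f w}
  have hdvd : ∀ w ∈ S, (p : ℤ) ∣ formValue f w := fun w hw =>
    (dvd_pow_self _ two_ne_zero).trans (Finset.mem_filter.mp hw).2
  have hz : ∀ w ∈ S, ¬ (p : ℤ) ∣ w.2 := fun w hw => not_dvd_snd_of_dvd_formValue hf hp hlead
    (mem_coprimeBox.mp (Finset.mem_filter.mp hw).1).2.2 (hdvd w hw)
  refine (Finset.card_le_mul_card_image S 9 fun c _ => ?_).trans
    (Nat.mul_le_mul_left _ (hK S hdvd))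
  refine card_le_nine_of_dvd_cross (m := (p : ℤ) ^ 2) (N := N) (by gcongr)
    ((Finset.filter_subset _ _).trans (Finset.filter_subset _ _)) fun w hw w' hw' => ?_
  obtain ⟨hwS, hwc⟩ := Finset.mem_filter.mp hw
  obtain ⟨hwS', hwc'⟩ := Finset.mem_filter.mp hw'
  exact pow_dvd_cross_of_dvd_cross hf hD hp hpD (hz w hwS) (hz w' hwS')
    (Finset.mem_filter.mp hwS).2 (Finset.mem_filter.mp hwS').2
    (dvd_cross_of_projClass_eq (hwc.trans hwc'.symm))

theorem exists_card_filter_sq_dvd_formValue_le (hf : f.IsHomogeneous n) (hn : n ≠ 0)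
    (hf0 : IsAnisotropic f) (hsq : Squarefree (MvPolynomial.map (Int.castRingHom ℚ) f)) :
    ∃ K : ℕ, ∀ N p : ℕ, p.Prime → N < p →
      {w ∈ coprimeBox N | (p : ℤ) ^ 2 ∣ formValue f w}.card ≤ K := by
  obtain ⟨D, hD0, A, B, hD⟩ := exists_bezout_derivative hf hn hf0 hsq
  have hc0 : (dehomogenize f).coeff n ≠ 0 := formValue_one_zero hf ▸ hf0 _ (by simp)
  obtain ⟨K, -, hK⟩ := exists_card_image_projClass_le hf hf0.ne_zero
  set M := (D * (dehomogenize f).coeff n).natAbs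
  refine ⟨9 * K + (2 * M + 1) ^ 2, fun N p hp hNp => ?_⟩
  by_cases hbad : (p : ℤ) ∣ D * (dehomogenize f).coeff n
  · have hpM : p ≤ M := Nat.le_of_dvd (Int.natAbs_pos.mpr (mul_ne_zero hD0 hc0))
      (Int.natCast_dvd.mp hbad)
    calc _ ≤ (coprimeBox N).card := Finset.card_filter_le _ _
      _ ≤ (2 * N + 1) ^ 2 := card_coprimeBox_le N
      _ ≤ (2 * M + 1) ^ 2 := by gcongr; omega
      _ ≤ _ := Nat.le_add_left _ _
  · exact (card_filter_sq_dvd_formValue_le hf hD hp (fun h => hbad (h.mul_right _))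
      (fun h => hbad (h.mul_left _)) hNp (hK p hp)).trans (Nat.le_add_right _ _)

theorem exists_card_filter_exists_prime_le (hf : f.IsHomogeneous n) (hn : n ≠ 0)
    (hf0 : IsAnisotropic f) (hsq : Squarefree (MvPolynomial.map (Int.castRingHom ℚ) f)) :
    ∃ K : ℕ, ∀ N L : ℕ, Set.ncard {w ∈ (coprimeBox N : Set (ℤ × ℤ)) |
      ∃ p : ℕ, p.Prime ∧ N < p ∧ p ≤ L ∧ (p : ℤ) ^ 2 ∣ formValue f w} ≤ K * L := by
  obtain ⟨K, hK⟩ := exists_card_filter_sq_dvd_formValue_le hf hn hf0 hsq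
  refine ⟨K, fun N L => ?_⟩
  set U := {p ∈ Finset.Icc 1 L | p.Prime ∧ N < p}.biUnion fun p =>
    {w ∈ coprimeBox N | (p : ℤ) ^ 2 ∣ formValue f w}
  calc _ ≤ (U : Set (ℤ × ℤ)).ncard := by
        refine Set.ncard_le_ncard ?_ U.finite_toSet
        rintro w ⟨hw, p, hp, hNp, hpL, hdvd⟩
        exact Finset.mem_coe.mpr (Finset.mem_biUnion.mpr ⟨p, by simp [hp, hNp, hpL, hp.one_le],
          Finset.mem_filter.mpr ⟨hw, hdvd⟩⟩)
    _ = U.card := Set.ncard_coe_finset U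
    _ ≤ {p ∈ Finset.Icc 1 L | p.Prime ∧ N < p}.card * K :=
        Finset.card_biUnion_le_card_mul _ _ _ fun p hp =>
          hK N p (Finset.mem_filter.mp hp).2.1 (Finset.mem_filter.mp hp).2.2
    _ ≤ K * L := by
        rw [mul_comm]
        gcongr
        exact (Finset.card_filter_le _ _).trans (by simp)

end Hensel

section Lattices

/-- The squared Euclidean norm of an integer vector. -/
def sqNorm (w : ℤ × ℤ) : ℤ := w.1 ^ 2 + w.2 ^ 2

theorem cross_sq_add_sq (w w' : ℤ × ℤ) :
    cross w w' ^ 2 + (w.1 * w'.1 + w.2 * w'.2) ^ 2 = sqNorm w * sqNorm w' := by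
  unfold cross sqNorm
  ring

theorem cross_sq_le (w w' : ℤ × ℤ) : cross w w' ^ 2 ≤ sqNorm w * sqNorm w' := by
  rw [← cross_sq_add_sq]
  exact le_add_of_nonneg_right (sq_nonneg _)

theorem sqNorm_nonneg (w : ℤ × ℤ) : 0 ≤ sqNorm w := by
  unfold sqNorm
  positivity

theorem sqNorm_le_of_abs_le {w : ℤ × ℤ} {N : ℤ} (h₁ : |w.1| ≤ N) (h₂ : |w.2| ≤ N) :
    sqNorm w ≤ 2 * N ^ 2 := by
  have hx := sq_le_sq' (abs_le.mp h₁).1 (abs_le.mp h₁).2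
  have hz := sq_le_sq' (abs_le.mp h₂).1 (abs_le.mp h₂).2
  unfold sqNorm
  linarith

/-- The lattice of integer vectors that are proportional to `w₀` modulo `d`; for primitive `w₀`
its index in `ℤ × ℤ` is `|d|`. -/
def parallelLattice (d : ℤ) (w₀ : ℤ × ℤ) : AddSubgroup (ℤ × ℤ) where
  carrier := {b | d ∣ cross b w₀}
  zero_mem' := by simp [cross]
  add_mem' {a b} ha hb := by
    have h : cross (a + b) w₀ = cross a w₀ + cross b w₀ := by
      simp only [cross, Prod.fst_add, Prod.snd_add]
      ring
    change d ∣ cross (a + b) w₀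
    exact h.symm ▸ dvd_add ha hb
  neg_mem' {a} ha := by
    have h : cross (-a) w₀ = -cross a w₀ := by
      simp only [cross, Prod.fst_neg, Prod.snd_neg]
      ring
    change d ∣ cross (-a) w₀
    exact h.symm ▸ (dvd_neg.mpr ha)

variable {d : ℤ} {w₀ : ℤ × ℤ}

theorem mem_parallelLattice {b : ℤ × ℤ} : b ∈ parallelLattice d w₀ ↔ d ∣ cross b w₀ :=
  Iff.rfl

theorem exists_basis_min_sqNorm_add (hw₀ : IsCoprime w₀.1 w₀.2) (d : ℤ) :
    ∃ b₁ ∈ parallelLattice d w₀, ∃ b₂ ∈ parallelLattice d w₀, cross b₁ b₂ = d ∧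
      ∀ c₁ ∈ parallelLattice d w₀, ∀ c₂ ∈ parallelLattice d w₀, cross c₁ c₂ = d →
        sqNorm b₁ + sqNorm b₂ ≤ sqNorm c₁ + sqNorm c₂ := by
  let bases : Set ((ℤ × ℤ) × (ℤ × ℤ)) :=
    {b | b.1 ∈ parallelLattice d w₀ ∧ b.2 ∈ parallelLattice d w₀ ∧ cross b.1 b.2 = d}
  have hne : bases.Nonempty := by
    obtain ⟨α, β, h⟩ := hw₀
    refine ⟨(w₀, (-(d * β), d * α)), ⟨0, ?_⟩, ⟨-1, ?_⟩, ?_⟩ <;> simp only [cross]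
    · ring
    · linear_combination -d * h
    · linear_combination d * h
  obtain ⟨⟨b₁, b₂⟩, ⟨h₁, h₂, hd⟩, hmin⟩ := (measure fun b : (ℤ × ℤ) × (ℤ × ℤ) =>
    (sqNorm b.1 + sqNorm b.2).toNat).wf.has_min bases hne
  refine ⟨b₁, h₁, b₂, h₂, hd, fun c₁ hc₁ c₂ hc₂ hc => ?_⟩
  have hle : (sqNorm b₁ + sqNorm b₂).toNat ≤ (sqNorm c₁ + sqNorm c₂).toNat :=
    not_lt.mp (hmin (c₁, c₂) ⟨hc₁, hc₂, hc⟩)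
  have := sqNorm_nonneg c₁
  have := sqNorm_nonneg c₂
  omega

/-- A Gauss-reduced basis: one minimizing `sqNorm b₁ + sqNorm b₂` cannot be improved by adding or
subtracting one vector to or from the other, so `2 |⟨b₁, b₂⟩|` is at most either squared norm. -/
theorem exists_reduced_basis (hw₀ : IsCoprime w₀.1 w₀.2) (d : ℤ) :
    ∃ b₁ ∈ parallelLattice d w₀, ∃ b₂ ∈ parallelLattice d w₀, cross b₁ b₂ ^ 2 = d ^ 2 ∧
      sqNorm b₁ ≤ sqNorm b₂ ∧ 3 * (sqNorm b₁ * sqNorm b₂) ≤ 4 * d ^ 2 := by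
  obtain ⟨b₁, h₁, b₂, h₂, hd, hmin⟩ := exists_basis_min_sqNorm_add hw₀ d
  have hadd₂ := hmin b₁ h₁ (b₂ + b₁) (add_mem h₂ h₁) (by rw [← hd]; simp [cross]; ring)
  have hsub₂ := hmin b₁ h₁ (b₂ - b₁) (sub_mem h₂ h₁) (by rw [← hd]; simp [cross]; ring)
  have hadd₁ := hmin (b₁ + b₂) (add_mem h₁ h₂) b₂ h₂ (by rw [← hd]; simp [cross]; ring)
  have hsub₁ := hmin (b₁ - b₂) (sub_mem h₁ h₂) b₂ h₂ (by rw [← hd]; simp [cross]; ring)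
  have hproduct : 3 * (sqNorm b₁ * sqNorm b₂) ≤ 4 * d ^ 2 := by
    have hlagrange := cross_sq_add_sq b₁ b₂
    set s := b₁.1 * b₂.1 + b₁.2 * b₂.2 with hs
    have hs₁ : |2 * s| ≤ sqNorm b₁ := by
      simp only [sqNorm, Prod.fst_add, Prod.snd_add, Prod.fst_sub, Prod.snd_sub] at *
      rw [abs_le]; constructor <;> linarith
    have hs₂ : |2 * s| ≤ sqNorm b₂ := by
      simp only [sqNorm, Prod.fst_add, Prod.snd_add, Prod.fst_sub, Prod.snd_sub] at *
      rw [abs_le]; constructor <;> linarith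
    have hmul := mul_le_mul hs₁ hs₂ (abs_nonneg _) (sqNorm_nonneg _)
    rw [abs_mul_abs_self] at hmul
    rw [hd] at hlagrange
    linarith
  rcases le_total (sqNorm b₁) (sqNorm b₂) with h | h
  · exact ⟨b₁, h₁, b₂, h₂, by rw [hd], h, hproduct⟩
  · refine ⟨b₂, h₂, b₁, h₁, ?_, h, by linarith⟩
    rw [← hd, cross, cross]
    ring

theorem dvd_cross_of_mem_parallelLattice (hw₀ : IsCoprime w₀.1 w₀.2) {w w' : ℤ × ℤ}
    (h : w ∈ parallelLattice d w₀) (h' : w' ∈ parallelLattice d w₀) : d ∣ cross w w' := by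
  obtain ⟨α, β, hαβ⟩ := hw₀
  have hcross : cross w w' = (α * w'.1 + β * w'.2) * cross w w₀ -
      (α * w.1 + β * w.2) * cross w' w₀ := by
    simp only [cross]
    linear_combination (w.2 * w'.1 - w.1 * w'.2) * hαβ
  exact hcross ▸ dvd_sub (h.mul_left _) (h'.mul_left _)

theorem dvd_formValue_of_mem_parallelLattice {n : ℕ} {f : MvPolynomial (Fin 2) ℤ}
    (hf : f.IsHomogeneous n) (hw₀ : IsCoprime w₀.1 w₀.2) (h : d ∣ formValue f w₀) {b : ℤ × ℤ}
    (hb : b ∈ parallelLattice d w₀) : d ∣ formValue f b := by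
  obtain ⟨α, β, hαβ⟩ := hw₀
  have cast_eq_zero {a : ℤ} (ha : d ∣ a) : (a : ZMod d.natAbs) = 0 :=
    (ZMod.intCast_zmod_eq_zero_iff_dvd _ _).mpr (Int.natAbs_dvd.mpr ha)
  have hcross := cast_eq_zero (mem_parallelLattice.mp hb)
  have hbezout := congrArg (Int.cast : ℤ → ZMod d.natAbs) hαβ
  push_cast [cross] at hcross hbezout
  have hparallel : ((b.1 : ZMod d.natAbs), (b.2 : ZMod d.natAbs)) =
      ((α * b.1 + β * b.2 : ℤ) : ZMod d.natAbs) •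
        ((w₀.1 : ZMod d.natAbs), (w₀.2 : ZMod d.natAbs)) := by
    ext <;> push_cast [Prod.smul_mk, smul_eq_mul]
    · linear_combination -(b.1 : ZMod d.natAbs) * hbezout + (β : ZMod d.natAbs) * hcross
    · linear_combination -(b.2 : ZMod d.natAbs) * hbezout - (α : ZMod d.natAbs) * hcross
  rw [← Int.natAbs_dvd, ← ZMod.intCast_zmod_eq_zero_iff_dvd, ← formValue_intCast, hparallel,
    formValue_smul hf, formValue_intCast, cast_eq_zero h, mul_zero]

theorem sq_mul_sqNorm_le {u N : ℤ} {w b b' : ℤ × ℤ} (hd : d ≠ 0) (hcross : cross w b' = d * u)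
    (hw : sqNorm w ≤ 2 * N ^ 2) (h : 3 * (sqNorm b * sqNorm b') ≤ 4 * d ^ 2) :
    u ^ 2 * sqNorm b ≤ 4 * N ^ 2 := by
  have hle : (d * u) ^ 2 ≤ 2 * N ^ 2 * sqNorm b' := by
    rw [← hcross]
    exact (cross_sq_le w b').trans (mul_le_mul_of_nonneg_right hw (sqNorm_nonneg b'))
  have hd2 : 0 < d ^ 2 := by positivity
  refine le_of_mul_le_mul_left ?_ hd2
  nlinarith [mul_le_mul_of_nonneg_right hle (sqNorm_nonneg b),
    mul_le_mul_of_nonneg_left h (sq_nonneg N), mul_nonneg (sq_nonneg N) hd2.le]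

theorem exists_basis_with_short_coordinates (hw₀ : IsCoprime w₀.1 w₀.2) (hd : d ≠ 0) :
    ∃ b₁ ∈ parallelLattice d w₀, ∃ b₂ ∈ parallelLattice d w₀, sqNorm b₁ ≤ sqNorm b₂ ∧
      d ^ 2 ≤ sqNorm b₁ * sqNorm b₂ ∧ 3 * (sqNorm b₁ * sqNorm b₂) ≤ 4 * d ^ 2 ∧
      ∀ N : ℤ, ∀ w ∈ parallelLattice d w₀, |w.1| ≤ N → |w.2| ≤ N →
        ∃ u v : ℤ, w = u • b₁ + v • b₂ ∧ u ^ 2 * sqNorm b₁ ≤ 4 * N ^ 2 ∧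
          v ^ 2 * sqNorm b₂ ≤ 4 * N ^ 2 := by
  obtain ⟨b₁, h₁, b₂, h₂, hb, hle, hmul⟩ := exists_reduced_basis hw₀ d
  refine ⟨b₁, h₁, b₂, h₂, hle, hb ▸ cross_sq_le b₁ b₂, hmul, fun N w hw hx hz => ?_⟩
  set e := cross b₁ b₂ with he
  have he0 : e ≠ 0 := by
    intro h0
    rw [h0] at hb
    exact hd (by nlinarith)
  have hed : e ∣ d := (Int.pow_dvd_pow_iff two_ne_zero).mp hb.dvd
  obtain ⟨u, hu⟩ := hed.trans (dvd_cross_of_mem_parallelLattice hw₀ hw h₂)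
  obtain ⟨v, hv⟩ := hed.trans (dvd_cross_of_mem_parallelLattice hw₀ h₁ hw)
  have hnorm := sqNorm_le_of_abs_le hx hz
  rw [← hb] at hmul
  have hv' : cross w b₁ = e * -v := by
    simp only [cross] at hv ⊢
    linear_combination -hv
  have hvnorm : (-v) ^ 2 * sqNorm b₂ ≤ 4 * N ^ 2 :=
    sq_mul_sqNorm_le he0 hv' hnorm (by rwa [mul_comm (sqNorm b₂)])
  refine ⟨u, v, ?_, sq_mul_sqNorm_le he0 hu hnorm hmul, by rwa [neg_sq] at hvnorm⟩
  simp only [cross] at he hu hv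
  ext <;> apply mul_left_cancel₀ he0 <;>
    simp only [Prod.fst_add, Prod.snd_add, Prod.smul_fst, Prod.smul_snd, smul_eq_mul]
  · linear_combination w.1 * he + b₁.1 * hu + b₂.1 * hv
  · linear_combination w.2 * he + b₁.2 * hu + b₂.2 * hv

end Lattices

section CharacterSums

theorem sum_map_formValue_eq_zero {n : ℕ} {f : MvPolynomial (Fin 2) ℤ} (hf : f.IsHomogeneous n)
    {R R' : Type*} [CommRing R] [Fintype R] [CommRing R'] [IsDomain R'] (χ : R →* R') {t : Rˣ}
    (ht : χ t ^ n ≠ 1) : ∑ w : R × R, χ (formValue f w) = 0 := by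
  have hscale : ∑ w : R × R, χ (formValue f w) = χ t ^ n * ∑ w : R × R, χ (formValue f w) := by
    rw [Finset.mul_sum, ← Equiv.sum_comp (MulAction.toPerm t : Equiv.Perm (R × R))]
    refine Finset.sum_congr rfl fun w _ => ?_
    rw [MulAction.toPerm_apply, Units.smul_def, formValue_smul hf, map_mul, map_pow]
  refine (mul_eq_zero.mp ?_).resolve_left (sub_ne_zero.mpr ht)
  linear_combination -hscale

section Periodic

variable {M : ℕ} [NeZero M]

theorem sum_range_zmod_add (g : ZMod M → ℤ) (m : ZMod M) :
    ∑ i ∈ Finset.range M, g (m + i) = ∑ a, g a := by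
  refine Finset.sum_nbij (fun i => m + i) (fun _ _ => Finset.mem_univ _) ?_ ?_ fun _ _ => rfl
  · intro i hi j hj hij
    rw [Finset.mem_coe, Finset.mem_range] at hi hj
    have h := (ZMod.natCast_eq_natCast_iff' i j M).mp (add_left_cancel hij)
    rwa [Nat.mod_eq_of_lt hi, Nat.mod_eq_of_lt hj] at h
  · intro a _
    exact ⟨(a - m).val, by simpa using ZMod.val_lt (a - m), by simp⟩

theorem sum_range_zmod_add_eq_div_mul_add_mod (g : ZMod M → ℤ) (m : ZMod M) (k : ℕ) :
    ∑ i ∈ Finset.range k, g (m + i) =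
      (k / M : ℕ) * ∑ a, g a + ∑ i ∈ Finset.range (k % M), g (m + i) := by
  suffices ∀ q r : ℕ, ∑ i ∈ Finset.range (q * M + r), g (m + i) =
      q * ∑ a, g a + ∑ i ∈ Finset.range r, g (m + i) by
    rw [← this, mul_comm, Nat.div_add_mod]
  intro q r
  induction q with
  | zero => simp
  | succ q ih =>
    rw [show (q + 1) * M + r = q * M + r + M by ring, Finset.sum_range_add, ih]
    have hperiod := sum_range_zmod_add g (m + (q * M + r : ℕ))
    simp only [Nat.cast_add, ← add_assoc] at hperiod ⊢
    rw [hperiod]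
    push_cast
    ring

theorem abs_sum_range_zmod_add_le {g : ZMod M → ℤ} {c : ℤ} (hg : ∀ a, |g a| ≤ c) (m : ZMod M)
    (k : ℕ) : |∑ i ∈ Finset.range k, g (m + i)| ≤ (k / M : ℕ) * |∑ a, g a| + M * c := by
  rw [sum_range_zmod_add_eq_div_mul_add_mod]
  refine (abs_add_le _ _).trans (add_le_add ?_ ?_)
  · rw [abs_mul, Nat.abs_cast]
  · calc |∑ i ∈ Finset.range (k % M), g (m + i)|
        ≤ ∑ _i ∈ Finset.range (k % M), c :=
          (Finset.abs_sum_le_sum_abs _ _).trans (Finset.sum_le_sum fun i _ => hg _)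
      _ = (k % M : ℕ) * c := by rw [Finset.sum_const, Finset.card_range, nsmul_eq_mul]
      _ ≤ M * c := by
        have hc := (abs_nonneg _).trans (hg 0)
        gcongr
        exact (Nat.mod_lt _ (NeZero.pos M)).le

theorem abs_sum_sum_range_zmod_add_le {φ : ZMod M × ZMod M → ℤ} (hφ : ∀ w, |φ w| ≤ 1)
    (hsum : ∑ w, φ w = 0) (m m' : ZMod M) (a b : ℕ) :
    |∑ i ∈ Finset.range a, ∑ j ∈ Finset.range b, φ (m + i, m' + j)| ≤ M * (a + b) := by
  have abs_sum_le {ι : Type} (s : Finset ι) (w : ι → ZMod M × ZMod M) :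
      |∑ i ∈ s, φ (w i)| ≤ s.card := by
    refine (Finset.abs_sum_le_sum_abs _ _).trans ((Finset.sum_le_card_nsmul _ _ 1
      fun i _ => hφ _).trans_eq ?_)
    rw [nsmul_one]
  have hcolumns : |∑ u, ∑ j ∈ Finset.range b, φ (u, m' + j)| ≤ M * M := by
    rw [Finset.sum_comm]
    refine (abs_sum_range_zmod_add_le (g := fun v => ∑ u, φ (u, v)) (c := M) (fun v => ?_)
      m' b).trans_eq ?_
    · simpa [ZMod.card] using abs_sum_le Finset.univ fun u => (u, v)
    · rw [← Fintype.sum_prod_type_right', hsum, abs_zero, mul_zero, zero_add]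
  refine (abs_sum_range_zmod_add_le (g := fun u => ∑ j ∈ Finset.range b, φ (u, m' + j)) (c := b)
    (fun u => ?_) m a).trans ?_
  · simpa using abs_sum_le (Finset.range b) fun j => (u, m' + j)
  · calc ((a / M : ℕ) : ℤ) * |∑ u, ∑ j ∈ Finset.range b, φ (u, m' + j)| + M * b
        ≤ (a / M : ℕ) * (M * M) + M * b := by gcongr
      _ = ((a / M * M : ℕ) : ℤ) * M + M * b := by push_cast; ring
      _ ≤ a * M + M * b := by gcongr; exact Nat.div_mul_le_self a M
      _ = M * (a + b) := by ring

end Periodic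

section Jacobi

/-- The Jacobi symbol `(· | M)` as a character of `ZMod M`. -/
def jacobiHom (M : ℕ) [NeZero M] : ZMod M →* ℤ where
  toFun a := jacobiSym a.val M
  map_one' := by
    rw [← jacobiSym.one_left M]
    exact jacobiSym.mod_left' ((ZMod.intCast_eq_intCast_iff _ _ M).mp (by simp))
  map_mul' a b := by
    rw [← jacobiSym.mul_left]
    exact jacobiSym.mod_left' ((ZMod.intCast_eq_intCast_iff _ _ M).mp (by simp))

theorem jacobiHom_intCast (M : ℕ) [NeZero M] (a : ℤ) : jacobiHom M a = jacobiSym a M :=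
  jacobiSym.mod_left' ((ZMod.intCast_eq_intCast_iff _ _ M).mp (by simp))

theorem abs_jacobiSym_le_one (a : ℤ) (M : ℕ) : |jacobiSym a M| ≤ 1 := by
  rcases jacobiSym.trichotomy a M with h | h | h <;> simp [h]

theorem exists_jacobiSym_mul_eq_neg_one {p q : ℕ} (hp : p.Prime) (hq : q.Prime) (hp2 : p ≠ 2)
    (hpq : p ≠ q) : ∃ t : ℤ, jacobiSym t (p * q) = -1 := by
  have := Fact.mk hp
  have := Fact.mk hq
  obtain ⟨a, ha⟩ := FiniteField.exists_nonsquare (F := ZMod p) (by rwa [ZMod.ringChar_zmod_n])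
  have hnonresidue : jacobiSym (a.val : ℤ) p = -1 := by
    rw [ZMod.nonsquare_iff_jacobiSym_eq_neg_one]
    simpa using ha
  obtain ⟨t, htp, htq⟩ := Nat.chineseRemainder ((Nat.coprime_primes hp hq).mpr hpq) a.val 1
  refine ⟨t, ?_⟩
  rw [jacobiSym.mul_right, jacobiSym.mod_left' (a₂ := (a.val : ℤ)) (by exact_mod_cast htp),
    hnonresidue, jacobiSym.mod_left' (a₁ := (t : ℤ)) (a₂ := 1) (by exact_mod_cast htq),
    jacobiSym.one_left, mul_one]

theorem sum_jacobiHom_formValue_eq_zero {n : ℕ} {f : MvPolynomial (Fin 2) ℤ}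
    (hf : f.IsHomogeneous n) (hn : Odd n) {M : ℕ} [NeZero M] {t : ℤ} (ht : jacobiSym t M = -1) :
    ∑ w : ZMod M × ZMod M, jacobiHom M (formValue f w) = 0 := by
  have hunit : IsUnit (t : ZMod M) := by
    rw [ZMod.coe_int_isUnit_iff_isCoprime, isCoprime_comm, Int.isCoprime_iff_gcd_eq_one]
    by_contra h
    rw [jacobiSym.eq_zero_iff_not_coprime.mpr h] at ht
    norm_num at ht
  refine sum_map_formValue_eq_zero hf (jacobiHom M) (t := hunit.unit) ?_
  rw [IsUnit.unit_spec, jacobiHom_intCast, ht, hn.neg_one_pow]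
  norm_num

/-- Since `n` is odd, scaling a point by a nonresidue `t` changes the sign of `(f(·) | p q)`,
so the complete sum vanishes. -/
theorem abs_sum_jacobiSym_formValue_le {n : ℕ} {f : MvPolynomial (Fin 2) ℤ}
    (hf : f.IsHomogeneous n) (hn : Odd n) {p q : ℕ} (hp : p.Prime) (hq : q.Prime) (hp2 : p ≠ 2)
    (hpq : p ≠ q) (m m' : ℤ) (a b : ℕ) :
    |∑ w ∈ Finset.Ico m (m + a) ×ˢ Finset.Ico m' (m' + b), jacobiSym (formValue f w) (p * q)| ≤
      p * q * (a + b) := by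
  have : NeZero (p * q) := ⟨mul_ne_zero hp.ne_zero hq.ne_zero⟩
  obtain ⟨t, ht⟩ := exists_jacobiSym_mul_eq_neg_one hp hq hp2 hpq
  have sum_Ico (g : ℤ → ℤ) (m : ℤ) (k : ℕ) :
      ∑ x ∈ Finset.Ico m (m + k), g x = ∑ i ∈ Finset.range k, g (m + i) := by
    rw [Int.Ico_eq_finset_map]
    simp
  have hvalue (x z : ℤ) : jacobiSym (formValue f (x, z)) (p * q) =
      jacobiHom (p * q) (formValue f ((x : ZMod (p * q)), (z : ZMod (p * q)))) := by
    rw [formValue_intCast f (x, z), jacobiHom_intCast]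
  have hbound := abs_sum_sum_range_zmod_add_le (fun w => abs_jacobiSym_le_one _ _)
    (sum_jacobiHom_formValue_eq_zero hf hn ht) m m' a b
  rw [Finset.sum_product, sum_Ico]
  simp only [sum_Ico, hvalue]
  push_cast at hbound ⊢
  exact hbound

end Jacobi

end CharacterSums

section SquareSieve

/-- The integer `m` is a square and is coprime to at least half of the primes in `P`, so that the
residue symbols `(m | p)`, `p ∈ P`, detect it in the square sieve. -/
def IsDetectedSquare (P : Finset ℕ) (m : ℤ) : Prop :=
  IsSquare m ∧ 2 * {p ∈ P | ((p : ℕ) : ℤ) ∣ m}.card ≤ P.card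

theorem IsDetectedSquare.card_le_two_mul_sum_jacobiSym {P : Finset ℕ} (hP : ∀ p ∈ P, p.Prime)
    {m : ℤ} (hm : IsDetectedSquare P m) : (P.card : ℤ) ≤ 2 * ∑ p ∈ P, jacobiSym m p := by
  obtain ⟨⟨y, rfl⟩, hcard⟩ := hm
  have hsymbol : ∑ p ∈ P, jacobiSym (y * y) p = ∑ p ∈ P, if (p : ℤ) ∣ y * y then 0 else 1 := by
    refine Finset.sum_congr rfl fun p hp => ?_
    have hpp := Nat.prime_iff_prime_int.mp (hP p hp)
    have : NeZero p := ⟨(hP p hp).ne_zero⟩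
    split_ifs with h
    · rw [jacobiSym.eq_zero_iff_not_coprime, Ne, ← Int.isCoprime_iff_gcd_eq_one, isCoprime_comm,
        hpp.coprime_iff_not_dvd, not_not]
      exact h
    · rw [← sq] at h ⊢
      refine jacobiSym.sq_one' (Int.isCoprime_iff_gcd_eq_one.mp ?_)
      exact ((hpp.coprime_iff_not_dvd).mpr fun hy => h (dvd_pow hy two_ne_zero)).symm
  have hsplit := Finset.card_filter_add_card_filter_not (s := P) (fun p : ℕ => (p : ℤ) ∣ y * y)
  rw [hsymbol, Finset.sum_ite, Finset.sum_const_zero, zero_add, Finset.sum_const, nsmul_one]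
  omega

theorem card_mul_card_sq_le_sum_jacobiSym {α : Type*} {S T : Finset α} (hST : S ⊆ T)
    {P : Finset ℕ} (hP : ∀ p ∈ P, p.Prime) {g : α → ℤ} (hS : ∀ s ∈ S, IsDetectedSquare P (g s)) :
    (S.card : ℤ) * P.card ^ 2 ≤
      4 * ∑ p ∈ P, ∑ q ∈ P, ∑ s ∈ T, jacobiSym (g s) p * jacobiSym (g s) q :=
  calc (S.card : ℤ) * P.card ^ 2 = ∑ _s ∈ S, (P.card : ℤ) ^ 2 := by
        rw [Finset.sum_const, nsmul_eq_mul]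
    _ ≤ ∑ s ∈ S, (2 * ∑ p ∈ P, jacobiSym (g s) p) ^ 2 := by
        gcongr with s hs
        exact (hS s hs).card_le_two_mul_sum_jacobiSym hP
    _ ≤ ∑ s ∈ T, (2 * ∑ p ∈ P, jacobiSym (g s) p) ^ 2 :=
        Finset.sum_le_sum_of_subset_of_nonneg hST fun _ _ _ => sq_nonneg _
    _ = 4 * ∑ s ∈ T, ∑ p ∈ P, ∑ q ∈ P, jacobiSym (g s) p * jacobiSym (g s) q := by
        rw [Finset.mul_sum]
        refine Finset.sum_congr rfl fun s _ => ?_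
        rw [← Finset.sum_mul_sum]
        ring
    _ = 4 * ∑ p ∈ P, ∑ q ∈ P, ∑ s ∈ T, jacobiSym (g s) p * jacobiSym (g s) q := by
        rw [Finset.sum_comm]
        simp only [Finset.sum_comm (s := T)]

variable {n : ℕ} {f : MvPolynomial (Fin 2) ℤ} {P : Finset ℕ} {Q : ℝ}

theorem sum_jacobiSym_mul_jacobiSym_formValue_le (hf : f.IsHomogeneous n) (hn : Odd n)
    (hP : ∀ p ∈ P, p.Prime ∧ p ≠ 2 ∧ (p : ℝ) ≤ Q) (m m' : ℤ) (a b : ℕ) {p q : ℕ} (hp : p ∈ P)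
    (hq : q ∈ P) :
    ((∑ w ∈ Finset.Ico m (m + a) ×ˢ Finset.Ico m' (m' + b),
      jacobiSym (formValue f w) p * jacobiSym (formValue f w) q : ℤ) : ℝ) ≤
      (if p = q then (a * b : ℝ) else 0) + Q ^ 2 * (a + b) := by
  obtain ⟨hpp, hp2, hpQ⟩ := hP p hp
  obtain ⟨hqp, -, hqQ⟩ := hP q hq
  split_ifs with hpq
  · refine (le_trans ?_ (le_add_of_nonneg_right (by positivity : 0 ≤ Q ^ 2 * (a + b))))
    have hterm (w : ℤ × ℤ) : jacobiSym (formValue f w) p * jacobiSym (formValue f w) q ≤ 1 := by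
      refine (le_abs_self _).trans ?_
      rw [abs_mul]
      exact mul_le_one₀ (abs_jacobiSym_le_one _ _) (abs_nonneg _) (abs_jacobiSym_le_one _ _)
    have hdiagonal := Finset.sum_le_card_nsmul
      (Finset.Ico m (m + a) ×ˢ Finset.Ico m' (m' + b)) _ 1 fun w _ => hterm w
    rw [Finset.card_product, Int.card_Ico, Int.card_Ico, nsmul_one, add_sub_cancel_left,
      add_sub_cancel_left, Int.toNat_natCast, Int.toNat_natCast] at hdiagonal
    exact_mod_cast hdiagonal
  · have : NeZero p := ⟨hpp.ne_zero⟩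
    have : NeZero q := ⟨hqp.ne_zero⟩
    have hoffDiagonal := (le_abs_self _).trans
      (abs_sum_jacobiSym_formValue_le hf hn hpp hqp hp2 hpq m m' a b)
    simp only [← jacobiSym.mul_right]
    calc ((∑ w ∈ Finset.Ico m (m + a) ×ˢ Finset.Ico m' (m' + b),
          jacobiSym (formValue f w) (p * q) : ℤ) : ℝ) ≤ p * q * (a + b) := by
          exact_mod_cast hoffDiagonal
      _ ≤ Q * Q * (a + b) := by gcongr; exact p.cast_nonneg.trans hpQ
      _ = 0 + Q ^ 2 * (a + b) := by ring

theorem card_mul_card_sq_le_of_isDetectedSquare_formValue (hf : f.IsHomogeneous n) (hn : Odd n)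
    (hP : ∀ p ∈ P, p.Prime ∧ p ≠ 2 ∧ (p : ℝ) ≤ Q) {m m' : ℤ} {a b : ℕ} {S : Finset (ℤ × ℤ)}
    (hbox : S ⊆ Finset.Ico m (m + a) ×ˢ Finset.Ico m' (m' + b))
    (hS : ∀ w ∈ S, IsDetectedSquare P (formValue f w)) :
    (S.card : ℝ) * P.card ^ 2 ≤ 4 * (P.card * (a * b) + P.card ^ 2 * (Q ^ 2 * (a + b))) := by
  have hsieve : (S.card : ℝ) * P.card ^ 2 ≤ 4 * ∑ p ∈ P, ∑ q ∈ P,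
      ((∑ w ∈ Finset.Ico m (m + a) ×ˢ Finset.Ico m' (m' + b),
        jacobiSym (formValue f w) p * jacobiSym (formValue f w) q : ℤ) : ℝ) := by
    exact_mod_cast card_mul_card_sq_le_sum_jacobiSym hbox (fun p hp => (hP p hp).1) hS
  refine hsieve.trans (mul_le_mul_of_nonneg_left ?_ zero_le_four)
  calc _ ≤ ∑ p ∈ P, ∑ q ∈ P, ((if p = q then (a * b : ℝ) else 0) + Q ^ 2 * (a + b)) :=
        Finset.sum_le_sum fun p hp => Finset.sum_le_sum fun q hq =>
          sum_jacobiSym_mul_jacobiSym_formValue_le hf hn hP m m' a b hp hq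
    _ = P.card * (a * b) + P.card ^ 2 * (Q ^ 2 * (a + b)) := by
        simp only [Finset.sum_add_distrib, Finset.sum_ite_eq, Finset.sum_ite_mem,
          Finset.inter_self, Finset.sum_const, nsmul_eq_mul]
        ring

end SquareSieve

section SieveOnLattices

variable {n : ℕ} {f : MvPolynomial (Fin 2) ℤ} {P : Finset ℕ} {Q : ℝ}

theorem exists_isHomogeneous_formValue_eq (hf : f.IsHomogeneous n) (d : ℤ) (b₁ b₂ : ℤ × ℤ) :
    ∃ g : MvPolynomial (Fin 2) ℤ, g.IsHomogeneous n ∧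
      ∀ u v : ℤ, formValue g (u, v) = d * formValue f (u • b₁ + v • b₂) := by
  let l : Fin 2 → MvPolynomial (Fin 2) ℤ :=
    ![.C b₁.1 * .X 0 + .C b₂.1 * .X 1, .C b₁.2 * .X 0 + .C b₂.2 * .X 1]
  have hl (i : Fin 2) : (l i).IsHomogeneous 1 := by
    fin_cases i <;>
      exact ((MvPolynomial.isHomogeneous_X ℤ 0).C_mul _).add
        ((MvPolynomial.isHomogeneous_X ℤ 1).C_mul _)
  refine ⟨.C d * MvPolynomial.aeval l f, (one_mul n ▸ hf.aeval l hl).C_mul d, fun u v => ?_⟩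
  have hpoint : (fun i => MvPolynomial.aeval ![u, v] (l i)) =
      ![(u • b₁ + v • b₂).1, (u • b₁ + v • b₂).2] := by
    ext i
    fin_cases i <;> simp [l, mul_comm]
  rw [formValue, map_mul, MvPolynomial.aeval_C, MvPolynomial.comp_aeval_apply, hpoint, formValue,
    Algebra.algebraMap_self_apply]

theorem card_mul_card_sq_le_of_isDetectedSquare_lattice (hf : f.IsHomogeneous n) (hn : Odd n)
    (hP : ∀ p ∈ P, p.Prime ∧ p ≠ 2 ∧ (p : ℝ) ≤ Q) {d : ℤ} {b₁ b₂ : ℤ × ℤ} {A B : ℕ}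
    {S : Finset (ℤ × ℤ)}
    (hcoord : ∀ w ∈ S, ∃ u v : ℤ, w = u • b₁ + v • b₂ ∧ |u| ≤ A ∧ |v| ≤ B)
    (hS : ∀ w ∈ S, IsDetectedSquare P (d * formValue f w)) :
    (S.card : ℝ) * P.card ^ 2 ≤ 4 * (P.card * ((2 * A + 1) * (2 * B + 1)) +
      P.card ^ 2 * (Q ^ 2 * ((2 * A + 1) + (2 * B + 1)))) := by
  classical
  obtain ⟨g, hg, hgf⟩ := exists_isHomogeneous_formValue_eq hf d b₁ b₂
  set box := Finset.Ico (-A : ℤ) (-A + (2 * A + 1 : ℕ)) ×ˢ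
    Finset.Ico (-B : ℤ) (-B + (2 * B + 1 : ℕ)) with hbox
  set T := {c ∈ box | c.1 • b₁ + c.2 • b₂ ∈ S} with hT
  have hST : S.card ≤ T.card := by
    refine (Finset.card_le_card (t := T.image fun c => c.1 • b₁ + c.2 • b₂) fun w hw => ?_).trans
      Finset.card_image_le
    obtain ⟨u, v, rfl, hu, hv⟩ := hcoord w hw
    rw [abs_le] at hu hv
    refine Finset.mem_image.mpr ⟨(u, v), Finset.mem_filter.mpr ⟨?_, hw⟩, rfl⟩
    rw [hbox, Finset.mem_product, Finset.mem_Ico, Finset.mem_Ico]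
    push_cast
    lia
  have hsieve := card_mul_card_sq_le_of_isDetectedSquare_formValue hg hn hP
    (Finset.filter_subset _ box) (S := T) fun c hc => by
      rw [← Prod.eta c, hgf]
      exact hS _ (Finset.mem_filter.mp hc).2
  push_cast at hsieve
  exact le_trans (by gcongr) hsieve

theorem abs_le_floor_div_sqrt {u m N : ℤ} (hm : 0 < m) (hN : 0 ≤ N)
    (h : u ^ 2 * m ≤ 4 * N ^ 2) : |u| ≤ (⌊2 * (N : ℝ) / √m⌋₊ : ℤ) := by
  have hsqrt : 0 < √(m : ℝ) := Real.sqrt_pos.mpr (Int.cast_pos.mpr hm)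
  have hu : |(u : ℝ) * √m| ≤ 2 * N := by
    refine abs_le_of_sq_le_sq ?_ (by positivity)
    rw [mul_pow, Real.sq_sqrt (Int.cast_nonneg hm.le)]
    norm_cast
    linarith
  rw [abs_mul, abs_of_pos hsqrt, ← le_div_iff₀ hsqrt] at hu
  rw [Int.abs_eq_natAbs, Int.ofNat_le]
  exact Nat.le_floor (by rwa [Nat.cast_natAbs, Int.cast_abs])

/-- The bound that the square sieve gives on a lattice of determinant `d` whose reduced basis has
lengths `s ≤ r`, for the coordinates of the points in a box of size `N`. -/
theorem le_of_mul_sq_le_sieve_bound {c R d s r N a b : ℝ} (hR : 1 ≤ R) (hQ : 1 ≤ Q) (hd : 0 < d)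
    (hs : 0 < s) (hsr : s ≤ r) (hdsr : d ≤ s * r) (hsN : s ≤ 2 * N) (hb0 : 0 ≤ b)
    (ha : a ≤ 4 * (N / s) + 1) (hb : b ≤ 4 * (N / r) + 1)
    (hc : c * R ^ 2 ≤ 4 * (R * (a * b) + R ^ 2 * (Q ^ 2 * (a + b)))) :
    c ≤ 96 * (N ^ 2 / (d * R)) + 72 * (Q ^ 2 * N / s) := by
  have hr : 0 < r := hs.trans_le hsr
  have hN : 0 < N := by linarith
  have hone : 1 ≤ 2 * (N / s) := by rwa [← mul_div_assoc, one_le_div hs]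
  have ha' : a ≤ 6 * (N / s) := by linarith
  have hb' : b ≤ 6 * (N / s) := by
    have : N / r ≤ N / s := by gcongr
    linarith
  have hab : a * b ≤ 24 * (N ^ 2 / d) + 6 * (N / s) :=
    calc a * b ≤ 6 * (N / s) * (4 * (N / r) + 1) := by gcongr
      _ = 24 * (N ^ 2 / (s * r)) + 6 * (N / s) := by field_simp; ring
      _ ≤ 24 * (N ^ 2 / d) + 6 * (N / s) := by gcongr
  have hRQ : R ≤ R ^ 2 * Q ^ 2 :=
    calc R = R * 1 * 1 := by ring
      _ ≤ R * R * Q ^ 2 := by gcongr; exact one_le_pow₀ hQ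
      _ = R ^ 2 * Q ^ 2 := by ring
  refine le_of_mul_le_mul_right (hc.trans ?_) (by positivity : 0 < R ^ 2)
  calc 4 * (R * (a * b) + R ^ 2 * (Q ^ 2 * (a + b)))
      ≤ 4 * (R * (24 * (N ^ 2 / d) + 6 * (N / s)) +
          R ^ 2 * (Q ^ 2 * (6 * (N / s) + 6 * (N / s)))) := by gcongr
    _ = 96 * (R * (N ^ 2 / d)) + 24 * (R * (N / s)) + 48 * (R ^ 2 * Q ^ 2 * (N / s)) := by ring
    _ ≤ 96 * (R * (N ^ 2 / d)) + 24 * (R ^ 2 * Q ^ 2 * (N / s)) +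
          48 * (R ^ 2 * Q ^ 2 * (N / s)) := by gcongr
    _ = (96 * (N ^ 2 / (d * R)) + 72 * (Q ^ 2 * N / s)) * R ^ 2 := by
      field_simp
      ring

theorem sqNorm_le_of_sq_mul_sqNorm_le {b₁ b₂ : ℤ × ℤ} (hle : sqNorm b₁ ≤ sqNorm b₂) {u v M : ℤ}
    (h : u • b₁ + v • b₂ ≠ 0) (hu : u ^ 2 * sqNorm b₁ ≤ M) (hv : v ^ 2 * sqNorm b₂ ≤ M) :
    sqNorm b₁ ≤ M := by
  by_cases hu0 : u = 0
  · have hv0 : v ≠ 0 := by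
      rintro rfl
      simp [hu0] at h
    have hv1 : 0 < v ^ 2 := by positivity
    nlinarith [sqNorm_nonneg b₂]
  · have hu1 : 0 < u ^ 2 := by positivity
    nlinarith [sqNorm_nonneg b₁]

theorem card_le_of_isDetectedSquare_lattice (hf : f.IsHomogeneous n) (hn : Odd n)
    (hPne : P.Nonempty) (hP : ∀ p ∈ P, p.Prime ∧ p ≠ 2 ∧ (p : ℝ) ≤ Q) {d : ℤ} (hd : d ≠ 0)
    {b₁ b₂ : ℤ × ℤ} (hb₁ : 0 < sqNorm b₁) (hle : sqNorm b₁ ≤ sqNorm b₂)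
    (hdet : d ^ 2 ≤ sqNorm b₁ * sqNorm b₂) {N : ℕ} {S : Finset (ℤ × ℤ)} (hS0 : 0 ∉ S)
    (hcoord : ∀ w ∈ S, ∃ u v : ℤ, w = u • b₁ + v • b₂ ∧
      u ^ 2 * sqNorm b₁ ≤ 4 * (N : ℤ) ^ 2 ∧ v ^ 2 * sqNorm b₂ ≤ 4 * (N : ℤ) ^ 2)
    (hS : ∀ w ∈ S, IsDetectedSquare P (d * formValue f w)) :
    (S.card : ℝ) ≤ 96 * (N ^ 2 / (|d| * P.card)) + 72 * (Q ^ 2 * N / √(sqNorm b₁)) := by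
  obtain rfl | ⟨w, hw⟩ := S.eq_empty_or_nonempty
  · rw [Finset.card_empty, Nat.cast_zero]
    positivity
  have hb₁N : sqNorm b₁ ≤ 4 * (N : ℤ) ^ 2 := by
    obtain ⟨u, v, rfl, hu, hv⟩ := hcoord w hw
    exact sqNorm_le_of_sq_mul_sqNorm_le hle (fun h => hS0 (h ▸ hw)) hu hv
  have hfloor (m : ℤ) : 2 * (⌊2 * ((N : ℤ) : ℝ) / √m⌋₊ : ℝ) + 1 ≤ 4 * (N / √m) + 1 := by
    have := Nat.floor_le (by positivity : 0 ≤ 2 * ((N : ℤ) : ℝ) / √m)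
    rw [Int.cast_natCast, mul_div_assoc] at this ⊢
    linarith
  have hsieve := card_mul_card_sq_le_of_isDetectedSquare_lattice hf hn hP (fun w hw => by
    obtain ⟨u, v, huv, hu, hv⟩ := hcoord w hw
    exact ⟨u, v, huv, abs_le_floor_div_sqrt hb₁ N.cast_nonneg hu,
      abs_le_floor_div_sqrt (hb₁.trans_le hle) N.cast_nonneg hv⟩) hS
  obtain ⟨p, hp⟩ := hPne
  have hP1 : (1 : ℝ) ≤ P.card := by exact_mod_cast Finset.card_pos.mpr ⟨p, hp⟩
  have hQ1 : 1 ≤ Q := le_trans (by exact_mod_cast (hP p hp).1.one_le) (hP p hp).2.2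
  refine le_of_mul_sq_le_sieve_bound hP1 hQ1 (by exact_mod_cast abs_pos.mpr hd)
    (Real.sqrt_pos.mpr (by exact_mod_cast hb₁)) (Real.sqrt_le_sqrt (by exact_mod_cast hle)) ?_ ?_
    (by positivity) (hfloor (sqNorm b₁)) (hfloor (sqNorm b₂)) hsieve
  · rw [← Real.sqrt_mul (by exact_mod_cast hb₁.le)]
    exact Real.le_sqrt_of_sq_le (by rw [← sq_abs] at hdet; exact_mod_cast hdet)
  · rw [Real.sqrt_le_left (by positivity), mul_pow]
    norm_num
    exact_mod_cast hb₁N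

theorem exists_sqNorm_le_and_card_le (hf : f.IsHomogeneous n) (hn : Odd n) (hPne : P.Nonempty)
    (hP : ∀ p ∈ P, p.Prime ∧ p ≠ 2 ∧ (p : ℝ) ≤ Q) {d : ℤ} (hd : d ≠ 0) {w₀ : ℤ × ℤ}
    (hw₀ : IsCoprime w₀.1 w₀.2) (hdw₀ : d ∣ formValue f w₀) {N : ℕ} {S : Finset (ℤ × ℤ)}
    (hSN : S ⊆ coprimeBox N) (hcross : ∀ w ∈ S, d ∣ cross w w₀)
    (hS : ∀ w ∈ S, IsDetectedSquare P (d * formValue f w)) :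
    ∃ b : ℤ × ℤ, 0 < sqNorm b ∧ sqNorm b ≤ 2 * |d| ∧ d ∣ formValue f b ∧
      (S.card : ℝ) ≤ 96 * (N ^ 2 / (|d| * P.card)) + 72 * (Q ^ 2 * N / √(sqNorm b)) := by
  obtain ⟨b₁, hb₁, b₂, -, hle, hdet, hdet', hcoord⟩ := exists_basis_with_short_coordinates hw₀ hd
  have hb₁pos : 0 < sqNorm b₁ := (sqNorm_nonneg b₁).lt_of_ne fun h => by
    rw [← h, zero_mul] at hdet
    exact hd (sq_nonpos_iff d |>.mp hdet)
  have hb₁le : sqNorm b₁ ≤ 2 * |d| := by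
    rw [← sq_abs d] at hdet'
    nlinarith [abs_nonneg d]
  refine ⟨b₁, hb₁pos, hb₁le, dvd_formValue_of_mem_parallelLattice hf hw₀ hdw₀ hb₁,
    card_le_of_isDetectedSquare_lattice hf hn hPne hP hd hb₁pos hle hdet
      (fun h => ne_zero_of_isCoprime (mem_coprimeBox.mp (hSN h)).2.2 rfl) (fun w hw => ?_) hS⟩
  obtain ⟨hx, hz, -⟩ := mem_coprimeBox.mp (hSN hw)
  exact hcoord N w (hcross w hw) hx hz

end SieveOnLattices

section Sums

theorem sum_comp_le_sum_mul {α ι : Type*} [DecidableEq ι] {T : Finset α} {I : Finset ι}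
    {φ : α → ι} (hφ : ∀ a ∈ T, φ a ∈ I) {c g : ι → ℝ} (hg : ∀ i ∈ I, 0 ≤ g i)
    (hc : ∀ i ∈ I, ({a ∈ T | φ a = i}.card : ℝ) ≤ c i) :
    ∑ a ∈ T, g (φ a) ≤ ∑ i ∈ I, c i * g i := by
  rw [← Finset.sum_fiberwise_of_maps_to hφ]
  refine Finset.sum_le_sum fun i hi => ?_
  rw [Finset.sum_congr rfl fun a ha => by rw [(Finset.mem_filter.mp ha).2], Finset.sum_const,
    nsmul_eq_mul]
  exact mul_le_mul_of_nonneg_right (hc i hi) (hg i hi)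

theorem max_natAbs_sq_le_sqNorm (b : ℤ × ℤ) :
    ((max b.1.natAbs b.2.natAbs : ℕ) : ℤ) ^ 2 ≤ sqNorm b := by
  have h₁ := sq_nonneg b.1
  have h₂ := sq_nonneg b.2
  rcases max_choice b.1.natAbs b.2.natAbs with h | h <;>
    rw [h, Int.natCast_natAbs, sq_abs, sqNorm] <;> linarith

theorem sum_one_div_sqrt_sqNorm_le {T : Finset (ℤ × ℤ)} {Y : ℝ}
    (hT : ∀ b ∈ T, 0 < sqNorm b ∧ (sqNorm b : ℝ) ≤ Y) :
    ∑ b ∈ T, 1 / √(sqNorm b) ≤ 8 * √Y := by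
  have hle (b : ℤ × ℤ) : ((max b.1.natAbs b.2.natAbs : ℕ) : ℝ) ≤ √(sqNorm b) :=
    Real.le_sqrt_of_sq_le (by
      rw [← Int.cast_natCast, ← Int.cast_pow]
      exact Int.cast_le.mpr (max_natAbs_sq_le_sqNorm b))
  have hpos (b : ℤ × ℤ) (hb : b ∈ T) : 0 < max b.1.natAbs b.2.natAbs := by
    by_contra! h
    have hzero : b = 0 := Prod.ext (by simp; omega) (by simp; omega)
    simpa [hzero, sqNorm] using (hT b hb).1
  calc ∑ b ∈ T, 1 / √(sqNorm b)
      ≤ ∑ b ∈ T, 1 / ((max b.1.natAbs b.2.natAbs : ℕ) : ℝ) := by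
        refine Finset.sum_le_sum fun b hb => ?_
        have := hpos b hb
        exact one_div_le_one_div_of_le (by exact_mod_cast this) (hle b)
    _ ≤ ∑ k ∈ Finset.Icc 1 ⌊√Y⌋₊, (8 * k : ℝ) * (1 / (k : ℝ)) := by
        refine sum_comp_le_sum_mul (φ := fun b : ℤ × ℤ => max b.1.natAbs b.2.natAbs)
          (g := fun k : ℕ => 1 / (k : ℝ)) (fun b hb => Finset.mem_Icc.mpr ⟨hpos b hb, ?_⟩)
          (fun k _ => by positivity) fun k hk => ?_
        · exact Nat.le_floor ((hle b).trans (Real.sqrt_le_sqrt (hT b hb).2))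
        · have hk0 : k ≠ 0 := Nat.one_le_iff_ne_zero.mp (Finset.mem_Icc.mp hk).1
          have hbox : {b ∈ T | max b.1.natAbs b.2.natAbs = k} ⊆ Finset.box k := fun b hb =>
            Int.mem_box.mpr (Finset.mem_filter.mp hb).2
          exact_mod_cast (Finset.card_le_card hbox).trans_eq (Int.card_box hk0)
    _ = ∑ _k ∈ Finset.Icc 1 ⌊√Y⌋₊, (8 : ℝ) := by
        refine Finset.sum_congr rfl fun k hk => ?_
        have hk0 : k ≠ 0 := Nat.one_le_iff_ne_zero.mp (Finset.mem_Icc.mp hk).1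
        field_simp
    _ ≤ 8 * √Y := by
        rw [Finset.sum_const, Nat.card_Icc, nsmul_eq_mul, add_tsub_cancel_right, mul_comm]
        gcongr
        exact Nat.floor_le (Real.sqrt_nonneg Y)

theorem card_filter_natAbs_eq_le_two (E : Finset ℤ) (k : ℕ) : {d ∈ E | d.natAbs = k}.card ≤ 2 := by
  refine (Finset.card_le_card (t := {(k : ℤ), -(k : ℤ)}) fun d hd => ?_).trans Finset.card_le_two
  rw [Finset.mem_insert, Finset.mem_singleton]
  exact Int.natAbs_eq_iff.mp (Finset.mem_filter.mp hd).2

theorem sum_one_div_abs_le {E : Finset ℤ} {D : ℕ} (hE : ∀ d ∈ E, d ≠ 0 ∧ |d| ≤ D) :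
    ∑ d ∈ E, 1 / (|d| : ℝ) ≤ 2 * (1 + Real.log D) := by
  have hharmonic := harmonic_le_one_add_log D
  rw [harmonic_eq_sum_Icc] at hharmonic
  push_cast at hharmonic
  calc ∑ d ∈ E, 1 / (|d| : ℝ) = ∑ d ∈ E, ((d.natAbs : ℝ))⁻¹ := by
        simp only [one_div, Nat.cast_natAbs, Int.cast_abs]
    _ ≤ ∑ k ∈ Finset.Icc 1 D, 2 * (k : ℝ)⁻¹ :=
        sum_comp_le_sum_mul (g := fun k : ℕ => (k : ℝ)⁻¹)
          (fun d hd => Finset.mem_Icc.mpr ⟨Int.natAbs_pos.mpr (hE d hd).1, by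
            rw [← Int.ofNat_le, Int.natCast_natAbs]
            exact (hE d hd).2⟩)
          (fun k _ => by positivity)
          fun k _ => by exact_mod_cast card_filter_natAbs_eq_le_two E k
    _ ≤ 2 * (1 + Real.log D) := by
        rw [← Finset.mul_sum]
        gcongr

end Sums

section SquarefreeParts

theorem exists_squarefree_mul_sq_eq (m : ℤ) : ∃ d t : ℤ, Squarefree d ∧ m = d * t ^ 2 := by
  obtain ⟨a, b, hab, ha⟩ := Nat.sq_mul_squarefree m.natAbs
  have hab' : ((m.natAbs : ℕ) : ℤ) = a * (b : ℤ) ^ 2 := by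
    rw [← hab]
    push_cast
    ring
  obtain h | h := m.natAbs_eq
  · exact ⟨a, b, Int.squarefree_natCast.mpr ha, h.trans hab'⟩
  · refine ⟨-a, b, ?_, by rw [h, hab', neg_mul]⟩
    rwa [← Int.squarefree_natAbs, Int.natAbs_neg, Int.natAbs_natCast]

theorem card_le_two_mul_two_pow_of_squarefree_dvd {m : ℤ} (hm : m ≠ 0) {E : Finset ℤ}
    (hE : ∀ d ∈ E, Squarefree d ∧ d ∣ m) : E.card ≤ 2 * 2 ^ m.natAbs.primeFactors.card := by
  refine (Finset.card_le_mul_card_image E 2 fun k _ => card_filter_natAbs_eq_le_two E k).trans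
    (Nat.mul_le_mul_left 2 ?_)
  rw [← Finset.card_powerset]
  have hmem (k : ℕ) (hk : k ∈ E.image Int.natAbs) : Squarefree k ∧ k ∣ m.natAbs := by
    obtain ⟨d, hd, rfl⟩ := Finset.mem_image.mp hk
    exact ⟨Int.squarefree_natAbs.mpr (hE d hd).1, Int.natAbs_dvd_natAbs.mpr (hE d hd).2⟩
  refine Finset.card_le_card_of_injOn Nat.primeFactors (fun k hk => ?_) fun k hk l hl h => ?_
  · exact Finset.mem_coe.mpr (Finset.mem_powerset.mpr
      (Nat.primeFactors_mono (hmem k hk).2 (Int.natAbs_ne_zero.mpr hm)))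
  · rw [← Nat.prod_primeFactors_of_squarefree (hmem k hk).1,
      ← Nat.prod_primeFactors_of_squarefree (hmem l hl).1, h]

theorem card_filter_dvd_le_card_primeFactors {P : Finset ℕ} (hP : ∀ p ∈ P, p.Prime) {m : ℤ}
    (hm : m ≠ 0) : {p ∈ P | ((p : ℕ) : ℤ) ∣ m}.card ≤ m.natAbs.primeFactors.card := by
  refine Finset.card_le_card fun p hp => ?_
  obtain ⟨hpP, hpm⟩ := Finset.mem_filter.mp hp
  exact Nat.mem_primeFactors.mpr ⟨hP p hpP, Int.natCast_dvd.mp hpm, Int.natAbs_ne_zero.mpr hm⟩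

theorem exists_pow_card_primeFactors_le {K : ℝ} (hK : 1 ≤ K) {ε : ℝ} (hε : 0 < ε) :
    ∃ C : ℝ, 1 ≤ C ∧ ∀ m : ℕ, m ≠ 0 → K ^ m.primeFactors.card ≤ C * (m : ℝ) ^ ε := by
  have hK0 : 0 ≤ K := zero_le_one.trans hK
  set B : ℕ := ⌈K ^ (1 / ε)⌉₊
  have hprime (p : ℕ) (hp : 1 ≤ p) : K ≤ (if p < B then K else 1) * (p : ℝ) ^ ε := by
    split_ifs with h
    · exact le_mul_of_one_le_right hK0 (Real.one_le_rpow (by exact_mod_cast hp) hε.le)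
    · have hBp : K ^ (1 / ε) ≤ p := (Nat.le_ceil _).trans (by exact_mod_cast not_lt.mp h)
      rw [one_mul]
      calc K = (K ^ (1 / ε)) ^ ε := by
            rw [← Real.rpow_mul hK0, one_div_mul_cancel hε.ne', Real.rpow_one]
        _ ≤ (p : ℝ) ^ ε := by gcongr
  refine ⟨K ^ B, one_le_pow₀ hK, fun m hm => ?_⟩
  calc K ^ m.primeFactors.card = ∏ _p ∈ m.primeFactors, K := (Finset.prod_const K).symm
    _ ≤ ∏ p ∈ m.primeFactors, ((if p < B then K else 1) * (p : ℝ) ^ ε) :=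
        Finset.prod_le_prod (fun _ _ => hK0) fun p hp =>
          hprime p (Nat.prime_of_mem_primeFactors hp).one_le
    _ = K ^ {p ∈ m.primeFactors | p < B}.card * (∏ p ∈ m.primeFactors, (p : ℝ)) ^ ε := by
        rw [Finset.prod_mul_distrib, Real.finsetProd_rpow _ _ (fun _ _ => by positivity),
          Finset.prod_ite, Finset.prod_const_one, mul_one, Finset.prod_const]
    _ ≤ K ^ B * (m : ℝ) ^ ε := by
        gcongr ?_ * ?_ ^ ε
        · refine pow_le_pow_right₀ hK ?_
          refine (Finset.card_le_card (t := Finset.range B) fun p hp => ?_).trans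
            (Finset.card_range B).le
          exact Finset.mem_range.mpr (Finset.mem_filter.mp hp).2
        · rw [← Nat.cast_prod]
          exact_mod_cast Nat.le_of_dvd (Nat.pos_of_ne_zero hm) (Nat.prod_primeFactors_dvd m)

end SquarefreeParts

section SmallSquarefreePart

variable {n : ℕ} {f : MvPolynomial (Fin 2) ℤ} {P : Finset ℕ} {Q : ℝ} {K : ℕ}

theorem exists_sqNorm_le_and_card_le_pow_mul (hf : f.IsHomogeneous n) (hn : Odd n)
    (hK : ∀ p : ℕ, p.Prime → ∀ S : Finset (ℤ × ℤ), (∀ w ∈ S, (p : ℤ) ∣ formValue f w) →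
      (S.image (projClass p)).card ≤ K)
    (hPne : P.Nonempty) (hP : ∀ p ∈ P, p.Prime ∧ p ≠ 2 ∧ (p : ℝ) ≤ Q) {d : ℤ} (hd : Squarefree d)
    {N : ℕ} {S : Finset (ℤ × ℤ)} (hne : S.Nonempty) (hSN : S ⊆ coprimeBox N)
    (hS : ∀ w ∈ S, d ∣ formValue f w ∧ IsDetectedSquare P (d * formValue f w)) :
    ∃ b : ℤ × ℤ, 0 < sqNorm b ∧ sqNorm b ≤ 2 * |d| ∧ d ∣ formValue f b ∧
      (S.card : ℝ) ≤ (K : ℝ) ^ d.natAbs.primeFactors.card *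
        (96 * (N ^ 2 / (|d| * P.card)) + 72 * (Q ^ 2 * N / √(sqNorm b))) := by
  obtain ⟨w₀, hw₀, hcard⟩ :=
    exists_card_le_pow_mul_card_filter_dvd_cross hd hne (fun w hw => (hS w hw).1) hK
  obtain ⟨b, hb0, hbd, hdvd, hb⟩ := exists_sqNorm_le_and_card_le hf hn hPne hP hd.ne_zero
    (mem_coprimeBox.mp (hSN hw₀)).2.2 (hS w₀ hw₀).1 (S := {w ∈ S | d ∣ cross w w₀})
    ((Finset.filter_subset _ _).trans hSN) (fun w hw => (Finset.mem_filter.mp hw).2)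
    fun w hw => (hS w (Finset.mem_filter.mp hw).1).2
  refine ⟨b, hb0, hbd, hdvd, ?_⟩
  calc (S.card : ℝ) ≤ (K : ℝ) ^ d.natAbs.primeFactors.card * {w ∈ S | d ∣ cross w w₀}.card := by
        exact_mod_cast hcard
    _ ≤ _ := by gcongr

theorem sum_one_div_sqrt_sqNorm_comp_le (hf0 : IsAnisotropic f) {κ Y : ℝ}
    (hκ0 : 0 ≤ κ) (hκ : ∀ b : ℤ × ℤ, 0 < sqNorm b → sqNorm b ≤ Y →
      2 * 2 ^ (formValue f b).natAbs.primeFactors.card ≤ κ)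
    {E : Finset ℤ} {b : ℤ → ℤ × ℤ}
    (hb : ∀ d ∈ E, Squarefree d ∧ 0 < sqNorm (b d) ∧ sqNorm (b d) ≤ Y ∧ d ∣ formValue f (b d)) :
    ∑ d ∈ E, 1 / √(sqNorm (b d)) ≤ κ * (8 * √Y) := by
  have himage (c : ℤ × ℤ) (hc : c ∈ E.image b) : 0 < sqNorm c ∧ (sqNorm c : ℝ) ≤ Y := by
    obtain ⟨d, hd, rfl⟩ := Finset.mem_image.mp hc
    exact ⟨(hb d hd).2.1, (hb d hd).2.2.1⟩
  have hfiber (c : ℤ × ℤ) (hc : c ∈ E.image b) : ({d ∈ E | b d = c}.card : ℝ) ≤ κ := by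
    obtain ⟨hc0, hcY⟩ := himage c hc
    refine le_trans ?_ (hκ c hc0 hcY)
    have hc : formValue f c ≠ 0 := hf0 c (by rintro rfl; simp [sqNorm] at hc0)
    exact_mod_cast card_le_two_mul_two_pow_of_squarefree_dvd hc fun d hd => by
      obtain ⟨hdE, rfl⟩ := Finset.mem_filter.mp hd
      exact ⟨(hb d hdE).1, (hb d hdE).2.2.2⟩
  calc ∑ d ∈ E, 1 / √(sqNorm (b d)) ≤ ∑ c ∈ E.image b, κ * (1 / √(sqNorm c)) :=
        sum_comp_le_sum_mul (g := fun c => 1 / √(sqNorm c))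
          (fun d hd => Finset.mem_image_of_mem b hd) (fun c _ => by positivity) hfiber
    _ = κ * ∑ c ∈ E.image b, 1 / √(sqNorm c) := by rw [Finset.mul_sum]
    _ ≤ κ * (8 * √Y) := by
        gcongr
        exact sum_one_div_sqrt_sqNorm_le himage

theorem sum_card_le_of_squarefree (hf : f.IsHomogeneous n) (hn : Odd n) (hf0 : IsAnisotropic f)
    (hK : ∀ p : ℕ, p.Prime → ∀ S : Finset (ℤ × ℤ), (∀ w ∈ S, (p : ℤ) ∣ formValue f w) →
      (S.image (projClass p)).card ≤ K)
    (hPne : P.Nonempty) (hP : ∀ p ∈ P, p.Prime ∧ p ≠ 2 ∧ (p : ℝ) ≤ Q) {D : ℕ} {κ : ℝ}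
    (hκd : ∀ d : ℤ, d ≠ 0 → |d| ≤ D → (K : ℝ) ^ d.natAbs.primeFactors.card ≤ κ)
    (hκb : ∀ b : ℤ × ℤ, 0 < sqNorm b → (sqNorm b : ℝ) ≤ 2 * D →
      2 * 2 ^ (formValue f b).natAbs.primeFactors.card ≤ κ)
    (hκD : 1 + Real.log D ≤ κ) {N : ℕ} {E : Finset ℤ} {S : ℤ → Finset (ℤ × ℤ)}
    (hE : ∀ d ∈ E, |d| ≤ D ∧ Squarefree d ∧ (S d).Nonempty ∧ S d ⊆ coprimeBox N)
    (hS : ∀ d ∈ E, ∀ w ∈ S d, d ∣ formValue f w ∧ IsDetectedSquare P (d * formValue f w)) :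
    ∑ d ∈ E, ((S d).card : ℝ) ≤
      κ ^ 2 * (192 * (N ^ 2 / P.card) + 576 * (Q ^ 2 * N * √(2 * D))) := by
  have hκ0 : 0 ≤ κ := le_trans (add_nonneg zero_le_one (Real.log_natCast_nonneg D)) hκD
  have hclass (d : ℤ) (hd : d ∈ E) := exists_sqNorm_le_and_card_le_pow_mul hf hn hK hPne hP
    (hE d hd).2.1 (hE d hd).2.2.1 (hE d hd).2.2.2 (hS d hd)
  choose! b hb0 hbd hdvd hcard using hclass
  simp only [Int.cast_abs] at hcard
  have hsum₁ : ∑ d ∈ E, 1 / (|d| : ℝ) ≤ 2 * κ :=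
    (sum_one_div_abs_le fun d hd => ⟨(hE d hd).2.1.ne_zero, (hE d hd).1⟩).trans (by linarith)
  have hsum₂ : ∑ d ∈ E, 1 / √(sqNorm (b d)) ≤ κ * (8 * √(2 * D)) :=
    sum_one_div_sqrt_sqNorm_comp_le hf0 hκ0 hκb fun d hd => ⟨(hE d hd).2.1, hb0 d hd, by
      have := (hbd d hd).trans (mul_le_mul_of_nonneg_left (hE d hd).1 zero_le_two)
      exact_mod_cast this, hdvd d hd⟩
  calc ∑ d ∈ E, ((S d).card : ℝ) ≤ ∑ d ∈ E, κ * (96 * (N ^ 2 / P.card) * (1 / |(d : ℝ)|) +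
          72 * (Q ^ 2 * N) * (1 / √(sqNorm (b d)))) := by
        refine Finset.sum_le_sum fun d hd => (hcard d hd).trans ?_
        have hκd' := hκd d (hE d hd).2.1.ne_zero (hE d hd).1
        rw [mul_comm |(d : ℝ)|, ← div_div, mul_assoc, mul_assoc, mul_one_div, mul_one_div]
        gcongr
    _ = κ * (96 * (N ^ 2 / P.card) * ∑ d ∈ E, 1 / (|d| : ℝ) +
          72 * (Q ^ 2 * N) * ∑ d ∈ E, 1 / √(sqNorm (b d))) := by
        rw [← Finset.mul_sum, Finset.sum_add_distrib, Finset.mul_sum, Finset.mul_sum]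
    _ ≤ κ * (96 * (N ^ 2 / P.card) * (2 * κ) + 72 * (Q ^ 2 * N) * (κ * (8 * √(2 * D)))) := by
        gcongr
    _ = κ ^ 2 * (192 * (N ^ 2 / P.card) + 576 * (Q ^ 2 * N * √(2 * D))) := by ring

theorem card_le_of_exists_squarefree (hf : f.IsHomogeneous n) (hn : Odd n) (hf0 : IsAnisotropic f)
    (hK : ∀ p : ℕ, p.Prime → ∀ S : Finset (ℤ × ℤ), (∀ w ∈ S, (p : ℤ) ∣ formValue f w) →
      (S.image (projClass p)).card ≤ K)
    (hPne : P.Nonempty) (hP : ∀ p ∈ P, p.Prime ∧ p ≠ 2 ∧ (p : ℝ) ≤ Q) {D : ℕ} {κ : ℝ}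
    (hκd : ∀ d : ℤ, d ≠ 0 → |d| ≤ D → (K : ℝ) ^ d.natAbs.primeFactors.card ≤ κ)
    (hκb : ∀ b : ℤ × ℤ, 0 < sqNorm b → (sqNorm b : ℝ) ≤ 2 * D →
      2 * 2 ^ (formValue f b).natAbs.primeFactors.card ≤ κ)
    (hκD : 1 + Real.log D ≤ κ) {N : ℕ} {U : Finset (ℤ × ℤ)} (hUN : U ⊆ coprimeBox N)
    (hU : ∀ w ∈ U, ∃ d : ℤ, Squarefree d ∧ |d| ≤ D ∧ d ∣ formValue f w ∧
      IsDetectedSquare P (d * formValue f w)) :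
    (U.card : ℝ) ≤ κ ^ 2 * (192 * (N ^ 2 / P.card) + 576 * (Q ^ 2 * N * √(2 * D))) := by
  classical
  set S : ℤ → Finset (ℤ × ℤ) := fun d =>
    {w ∈ U | d ∣ formValue f w ∧ IsDetectedSquare P (d * formValue f w)}
  set E := {d ∈ Finset.Icc (-D : ℤ) D | Squarefree d ∧ (S d).Nonempty} with hE
  have hUE : U.card ≤ ∑ d ∈ E, (S d).card := by
    refine (Finset.card_le_card (t := E.biUnion S) fun w hw => ?_).trans Finset.card_biUnion_le
    obtain ⟨d, hd, hdD, hdS⟩ := hU w hw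
    have hwS : w ∈ S d := Finset.mem_filter.mpr ⟨hw, hdS⟩
    exact Finset.mem_biUnion.mpr ⟨d, Finset.mem_filter.mpr
      ⟨Finset.mem_Icc.mpr (abs_le.mp hdD), hd, w, hwS⟩, hwS⟩
  calc (U.card : ℝ) ≤ ∑ d ∈ E, ((S d).card : ℝ) := by exact_mod_cast hUE
    _ ≤ _ := by
      refine sum_card_le_of_squarefree hf hn hf0 hK hPne hP hκd hκb hκD (fun d hd => ?_)
        fun d _ w hw => (Finset.mem_filter.mp hw).2
      rw [hE, Finset.mem_filter, Finset.mem_Icc, ← abs_le] at hd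
      exact ⟨hd.1, hd.2.1, hd.2.2, (Finset.filter_subset _ _).trans hUN⟩

end SmallSquarefreePart

section DivisorBounds

variable {n : ℕ} {f : MvPolynomial (Fin 2) ℤ}

theorem mul_pow_rpow_div_le {H ε : ℝ} (hH : 1 ≤ H) (hε : 0 < ε) (m : ℕ) {N : ℕ} (hN : 1 ≤ N) :
    (H * N ^ m) ^ (ε / (m + 1)) ≤ H ^ (ε / (m + 1)) * (N : ℝ) ^ ε := by
  have hN' : (1 : ℝ) ≤ N := by exact_mod_cast hN
  rw [Real.mul_rpow (by positivity) (by positivity), ← Real.rpow_natCast, ← Real.rpow_mul (by simp)]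
  gcongr
  rw [mul_div_assoc', div_le_iff₀ (by positivity)]
  linarith

theorem exists_pow_card_primeFactors_le_of_abs_le {K H ε : ℝ} (hK : 1 ≤ K) (hH : 1 ≤ H)
    (hε : 0 < ε) (m : ℕ) :
    ∃ C : ℝ, 1 ≤ C ∧ ∀ N : ℕ, 1 ≤ N → ∀ a : ℤ, a ≠ 0 → |(a : ℝ)| ≤ H * N ^ m →
      K ^ a.natAbs.primeFactors.card ≤ C * (N : ℝ) ^ ε := by
  obtain ⟨C, hC1, hC⟩ := exists_pow_card_primeFactors_le hK (ε := ε / (m + 1)) (by positivity)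
  refine ⟨C * H ^ (ε / (m + 1)),
    one_le_mul_of_one_le_of_one_le hC1 (Real.one_le_rpow hH (by positivity)),
    fun N hN a ha haN => ?_⟩
  calc K ^ a.natAbs.primeFactors.card ≤ C * (a.natAbs : ℝ) ^ (ε / (m + 1)) :=
        hC _ (Int.natAbs_ne_zero.mpr ha)
    _ ≤ C * (H * N ^ m) ^ (ε / (m + 1)) := by
        gcongr
        rwa [Nat.cast_natAbs, Int.cast_abs]
    _ ≤ C * (H ^ (ε / (m + 1)) * (N : ℝ) ^ ε) := by
        gcongr
        exact mul_pow_rpow_div_le hH hε m hN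
    _ = C * H ^ (ε / (m + 1)) * (N : ℝ) ^ ε := by ring

theorem exists_one_add_log_le {H ε : ℝ} (hH : 1 ≤ H) (hε : 0 < ε) (m : ℕ) :
    ∃ C : ℝ, 0 ≤ C ∧ ∀ N : ℕ, 1 ≤ N → ∀ D : ℕ, (D : ℝ) ≤ H * N ^ m →
      1 + Real.log D ≤ C * (N : ℝ) ^ ε := by
  refine ⟨1 + H ^ (ε / (m + 1)) / (ε / (m + 1)), by positivity, fun N hN D hD => ?_⟩
  have hN1 : 1 ≤ (N : ℝ) ^ ε := Real.one_le_rpow (by exact_mod_cast hN) hε.le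
  have hlog : Real.log D ≤ H ^ (ε / (m + 1)) * (N : ℝ) ^ ε / (ε / (m + 1)) :=
    calc Real.log D ≤ (D : ℝ) ^ (ε / (m + 1)) / (ε / (m + 1)) :=
          Real.log_le_rpow_div D.cast_nonneg (by positivity)
      _ ≤ (H * N ^ m) ^ (ε / (m + 1)) / (ε / (m + 1)) := by gcongr
      _ ≤ _ := by
        gcongr
        exact mul_pow_rpow_div_le hH hε m hN
  rw [add_mul, one_mul, div_mul_eq_mul_div]
  exact add_le_add hN1 hlog

theorem exists_two_pow_card_primeFactors_formValue_le (hf : f.IsHomogeneous n)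
    (hf0 : IsAnisotropic f) {H ε : ℝ} (hH : 1 ≤ H) (hε : 0 < ε) (m : ℕ) :
    ∃ C : ℝ, 1 ≤ C ∧ ∀ N : ℕ, 1 ≤ N → ∀ b : ℤ × ℤ, b ≠ 0 →
      |(b.1 : ℝ)| ≤ H * N ^ m → |(b.2 : ℝ)| ≤ H * N ^ m →
      2 * 2 ^ (formValue f b).natAbs.primeFactors.card ≤ C * (N : ℝ) ^ ε := by
  obtain ⟨G, hG1, hG⟩ := exists_abs_formValue_le hf
  obtain ⟨C, hC1, hC⟩ := exists_pow_card_primeFactors_le_of_abs_le one_le_two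
    (one_le_mul_of_one_le_of_one_le hG1 (one_le_pow₀ hH (n := n))) hε (m * n)
  refine ⟨2 * C, by linarith, fun N hN b hb h₁ h₂ => ?_⟩
  rw [mul_assoc]
  gcongr
  refine hC N hN _ (hf0 b hb) ((hG b _ h₁ h₂).trans_eq ?_)
  ring

theorem exists_formValue_divisor_bounds (hf : f.IsHomogeneous n) (hf0 : IsAnisotropic f)
    {K H ε : ℝ} (hK : 1 ≤ K) (hH : 1 ≤ H) (hε : 0 < ε) :
    ∃ C : ℝ, 1 ≤ C ∧ ∀ N : ℕ, 1 ≤ N → ∀ D : ℕ, (D : ℝ) ≤ H * N ^ n →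
      (∀ d : ℤ, d ≠ 0 → |d| ≤ D → K ^ d.natAbs.primeFactors.card ≤ C * (N : ℝ) ^ ε) ∧
      (∀ b : ℤ × ℤ, 0 < sqNorm b → (sqNorm b : ℝ) ≤ 2 * D →
        2 * 2 ^ (formValue f b).natAbs.primeFactors.card ≤ C * (N : ℝ) ^ ε) ∧
      1 + Real.log D ≤ C * (N : ℝ) ^ ε ∧
      ∀ w ∈ coprimeBox N,
        2 * ((formValue f w).natAbs.primeFactors.card : ℝ) ≤ C * (N : ℝ) ^ ε := by
  obtain ⟨C₁, hC₁1, hC₁⟩ := exists_pow_card_primeFactors_le_of_abs_le hK hH hε n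
  obtain ⟨C₂, hC₂1, hC₂⟩ := exists_two_pow_card_primeFactors_formValue_le hf hf0
    (show 1 ≤ 2 * H by linarith) hε n
  obtain ⟨C₃, hC₃0, hC₃⟩ := exists_one_add_log_le hH hε n
  obtain ⟨C₄, hC₄1, hC₄⟩ := exists_two_pow_card_primeFactors_formValue_le hf hf0 le_rfl hε 1
  have hmono {A B x : ℝ} {N : ℕ} (hx : x ≤ A * (N : ℝ) ^ ε) (hAB : A ≤ B) :
      x ≤ B * (N : ℝ) ^ ε := hx.trans (by gcongr)
  refine ⟨C₁ + C₂ + C₃ + C₄, by linarith, fun N hN D hD => ⟨fun d hd0 hd => ?_, fun b hb0 hb => ?_,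
    hmono (hC₃ N hN D hD) (by linarith), fun w hw => ?_⟩⟩
  · exact hmono (hC₁ N hN d hd0 (le_trans (by exact_mod_cast hd) hD)) (by linarith)
  · have hb' : b ≠ 0 := by
      rintro rfl
      simp [sqNorm] at hb0
    have hcoord (a : ℤ) (ha : a ^ 2 ≤ sqNorm b) : |(a : ℝ)| ≤ 2 * H * N ^ n :=
      calc |(a : ℝ)| ≤ sqNorm b := by
            exact_mod_cast (abs_le_of_sq_le_sq (by nlinarith) hb0.le)
        _ ≤ 2 * D := hb
        _ ≤ 2 * H * N ^ n := by linarith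
    refine hmono (hC₂ N hN b hb' (hcoord _ ?_) (hcoord _ ?_)) (by linarith)
    · exact le_add_of_nonneg_right (sq_nonneg _)
    · exact le_add_of_nonneg_left (sq_nonneg _)
  · obtain ⟨h₁, h₂, hw'⟩ := mem_coprimeBox.mp hw
    have hpow := hC₄ N hN w (ne_zero_of_isCoprime hw') (by simpa using mod_cast h₁)
      (by simpa using mod_cast h₂)
    refine hmono (le_trans ?_ hpow) (by linarith)
    gcongr
    exact_mod_cast Nat.lt_two_pow_self.le

theorem isDetectedSquare_mul_of_eq_mul_sq {P : Finset ℕ} (hP : ∀ p ∈ P, p.Prime) {m d t : ℤ}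
    (hm : m ≠ 0) (h : m = d * t ^ 2) (hcard : 2 * m.natAbs.primeFactors.card ≤ P.card) :
    IsDetectedSquare P (d * m) := by
  refine ⟨⟨d * t, by rw [h]; ring⟩, le_trans (Nat.mul_le_mul_left 2 ?_) hcard⟩
  refine le_trans (Finset.card_le_card ?_) (card_filter_dvd_le_card_primeFactors hP hm)
  refine Finset.monotone_filter_right P fun p hp hdvd => ?_
  rcases (Nat.prime_iff_prime_int.mp (hP p hp)).dvd_or_dvd hdvd with hpd | hpm
  · exact hpd.trans ⟨t ^ 2, h⟩
  · exact hpm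

theorem card_le_of_subset_coprimeBox_of_lt {N : ℕ} (hN : 1 ≤ N) {U : Finset (ℤ × ℤ)}
    (hUN : U ⊆ coprimeBox N) {r κ : ℝ} (hr : 0 ≤ r) (hrκ : r < κ) :
    (U.card : ℝ) ≤ 9 * (1 + κ) * (N ^ 2 / (r + 1)) := by
  have hN' : (1 : ℝ) ≤ N := by exact_mod_cast hN
  have hbox : (U.card : ℝ) ≤ (2 * N + 1) ^ 2 := by
    exact_mod_cast (Finset.card_le_card hUN).trans (card_coprimeBox_le N)
  calc (U.card : ℝ) ≤ 9 * N ^ 2 := hbox.trans (by nlinarith)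
    _ = 9 * (r + 1) * (N ^ 2 / (r + 1)) := by field_simp
    _ ≤ 9 * (1 + κ) * (N ^ 2 / (r + 1)) := by
      gcongr 9 * ?_ * _
      linarith

theorem card_le_of_squarefree_mul_sq (hf : f.IsHomogeneous n) (hn : Odd n)
    (hf0 : IsAnisotropic f) {K : ℕ}
    (hK : ∀ p : ℕ, p.Prime → ∀ S : Finset (ℤ × ℤ), (∀ w ∈ S, (p : ℤ) ∣ formValue f w) →
      (S.image (projClass p)).card ≤ K)
    {P : Finset ℕ} {Q : ℝ} (hP : ∀ p ∈ P, p.Prime ∧ p ≠ 2 ∧ (p : ℝ) ≤ Q) {D : ℕ} {κ : ℝ}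
    (hκd : ∀ d : ℤ, d ≠ 0 → |d| ≤ D → (K : ℝ) ^ d.natAbs.primeFactors.card ≤ κ)
    (hκb : ∀ b : ℤ × ℤ, 0 < sqNorm b → (sqNorm b : ℝ) ≤ 2 * D →
      2 * 2 ^ (formValue f b).natAbs.primeFactors.card ≤ κ)
    (hκD : 1 + Real.log D ≤ κ) {N : ℕ} (hN : 1 ≤ N) {U : Finset (ℤ × ℤ)} (hUN : U ⊆ coprimeBox N)
    (hω : ∀ w ∈ U, 2 * ((formValue f w).natAbs.primeFactors.card : ℝ) ≤ κ)
    (hU : ∀ w ∈ U, ∃ d t : ℤ, Squarefree d ∧ |d| ≤ D ∧ formValue f w = d * t ^ 2) :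
    (U.card : ℝ) ≤ 864 * κ ^ 2 * (N ^ 2 / (P.card + 1) + Q ^ 2 * N * √D) := by
  have hκ1 : 1 ≤ κ := by linarith [Real.log_natCast_nonneg D]
  obtain hPκ | hPκ := lt_or_ge (P.card : ℝ) κ
  · refine (card_le_of_subset_coprimeBox_of_lt hN hUN P.card.cast_nonneg hPκ).trans ?_
    gcongr ?_ * ?_
    · nlinarith
    · exact le_add_of_nonneg_right (by positivity)
  · have hP1 : 1 ≤ (P.card : ℝ) := hκ1.trans hPκ
    have hPne : P.Nonempty := Finset.card_pos.mp (by exact_mod_cast hP1)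
    have hsieve := card_le_of_exists_squarefree hf hn hf0 hK hPne hP hκd hκb hκD hUN fun w hw => by
      obtain ⟨d, t, hd, hdD, h⟩ := hU w hw
      have hw0 := hf0 w (ne_zero_of_isCoprime (mem_coprimeBox.mp (hUN hw)).2.2)
      exact ⟨d, hd, hdD, ⟨t ^ 2, h⟩, isDetectedSquare_mul_of_eq_mul_sq (fun p hp => (hP p hp).1)
        hw0 h (by exact_mod_cast (hω w hw).trans hPκ)⟩
    have hcard : (N : ℝ) ^ 2 / P.card ≤ 2 * (N ^ 2 / (P.card + 1)) := by
      rw [mul_div_assoc', div_le_div_iff₀ (by positivity) (by positivity)]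
      nlinarith [sq_nonneg (N : ℝ)]
    have hsqrt : √(2 * D) ≤ 3 / 2 * √D := by
      rw [Real.sqrt_mul zero_le_two]
      gcongr
      exact Real.sqrt_le_iff.mpr (by norm_num)
    calc (U.card : ℝ) ≤ κ ^ 2 * (192 * (N ^ 2 / P.card) + 576 * (Q ^ 2 * N * √(2 * D))) := hsieve
      _ ≤ κ ^ 2 * (192 * (2 * (N ^ 2 / (P.card + 1))) +
            576 * (Q ^ 2 * N * (3 / 2 * √D))) := by gcongr
      _ = κ ^ 2 * (384 * (N ^ 2 / (P.card + 1)) + 864 * (Q ^ 2 * N * √D)) := by ring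
      _ ≤ κ ^ 2 * (864 * (N ^ 2 / (P.card + 1)) + 864 * (Q ^ 2 * N * √D)) := by
        gcongr
        norm_num
      _ = _ := by ring

theorem abs_le_natFloor {d : ℤ} {x : ℝ} (h : |(d : ℝ)| ≤ x) : |d| ≤ ⌊x⌋₊ := by
  rw [Int.abs_eq_natAbs]
  exact Nat.cast_le.mpr (Nat.le_floor (by rwa [Nat.cast_natAbs, Int.cast_abs]))

theorem exists_card_le_of_squarefree_mul_sq (hf : f.IsHomogeneous n) (hn : Odd n)
    (hf0 : IsAnisotropic f) {ε : ℝ} (hε : 0 < ε) :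
    ∃ C : ℝ, 0 ≤ C ∧ ∀ N : ℕ, 1 ≤ N → ∀ (P : Finset ℕ) (Q D : ℝ),
      (∀ p ∈ P, p.Prime ∧ p ≠ 2 ∧ (p : ℝ) ≤ Q) → ∀ U ⊆ coprimeBox N,
      (∀ w ∈ U, ∃ d t : ℤ, Squarefree d ∧ |(d : ℝ)| ≤ D ∧ formValue f w = d * t ^ 2) →
      (U.card : ℝ) ≤ C * (N : ℝ) ^ ε * (N ^ 2 / (P.card + 1) + Q ^ 2 * N * √D) := by
  obtain ⟨K, hK1, hK⟩ := exists_card_image_projClass_le hf hf0.ne_zero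
  obtain ⟨H, hH1, hH⟩ := exists_abs_formValue_le_on_coprimeBox hf
  obtain ⟨C₁, hC₁1, hC₁⟩ := exists_formValue_divisor_bounds hf hf0 (K := K)
    (by exact_mod_cast hK1) hH1 (half_pos hε)
  refine ⟨864 * C₁ ^ 2, by positivity, fun N hN P Q D hP U hUN hU => ?_⟩
  obtain rfl | ⟨w₀, hw₀⟩ := U.eq_empty_or_nonempty
  · rw [Finset.card_empty, Nat.cast_zero]
    positivity
  have hD0 : 0 ≤ D := by
    obtain ⟨d, t, -, hd, -⟩ := hU w₀ hw₀
    exact (abs_nonneg _).trans hd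
  set D' := ⌊min D (H * N ^ n)⌋₊
  have hD'D : (D' : ℝ) ≤ min D (H * N ^ n) := Nat.floor_le (by positivity)
  obtain ⟨hκd, hκb, hκD, hκw⟩ := hC₁ N hN D' (hD'D.trans (min_le_right _ _))
  have hU' (w : ℤ × ℤ) (hw : w ∈ U) :
      ∃ d t : ℤ, Squarefree d ∧ |d| ≤ D' ∧ formValue f w = d * t ^ 2 := by
    obtain ⟨d, t, hd, hdD, h⟩ := hU w hw
    have hw0 := hf0 w (ne_zero_of_isCoprime (mem_coprimeBox.mp (hUN hw)).2.2)
    refine ⟨d, t, hd, ?_, h⟩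
    have hdf : |(d : ℝ)| ≤ |((formValue f w : ℤ) : ℝ)| := by
      exact_mod_cast Int.le_of_dvd (abs_pos.mpr hw0) ((abs_dvd_abs d _).mpr ⟨t ^ 2, h⟩)
    exact abs_le_natFloor (le_min hdD (hdf.trans (hH N w (hUN hw))))
  have hbound := card_le_of_squarefree_mul_sq hf hn hf0 hK hP hκd hκb hκD hN hUN
    (fun w hw => hκw w (hUN hw)) hU'
  calc (U.card : ℝ) ≤ 864 * (C₁ * (N : ℝ) ^ (ε / 2)) ^ 2 *
        (N ^ 2 / (P.card + 1) + Q ^ 2 * N * √D') := hbound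
    _ ≤ 864 * (C₁ * (N : ℝ) ^ (ε / 2)) ^ 2 * (N ^ 2 / (P.card + 1) + Q ^ 2 * N * √D) := by
        gcongr
        exact hD'D.trans (min_le_left _ _)
    _ = _ := by
        rw [mul_pow, ← Real.rpow_natCast (_ ^ (ε / 2)), ← Real.rpow_mul N.cast_nonneg,
          Nat.cast_ofNat, div_mul_cancel₀ _ two_ne_zero, ← mul_assoc]

end DivisorBounds

section LargeSquareDivisors

variable {n : ℕ} {f : MvPolynomial (Fin 2) ℤ}

theorem div_four_le_primeCounting_mul_log {x : ℝ} (hx : 16 ≤ x) :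
    x / 4 ≤ Nat.primeCounting ⌊x⌋₊ * Real.log x := by
  have hchebyshev := Chebyshev.pi_ge' (show 1 < x by linarith)
  rw [div_le_iff₀ (Real.log_pos (by linarith))] at hchebyshev
  have hlog : Real.log (x + 2) ≤ 4 * Real.log 2 + ((x + 2) / 16 - 1) := by
    calc Real.log (x + 2) = Real.log (2 ^ 4) + Real.log ((x + 2) / 16) := by
          rw [← Real.log_mul (by norm_num) (by linarith)]
          congr 1
          ring
      _ ≤ 4 * Real.log 2 + ((x + 2) / 16 - 1) := by
          rw [Real.log_pow, Nat.cast_ofNat]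
          gcongr
          exact Real.log_le_sub_one_of_pos (by linarith)
  nlinarith [Real.log_two_gt_d9, Real.log_two_lt_d9]

theorem exists_finset_odd_primes {ε : ℝ} (hε : 0 < ε) :
    ∃ C : ℝ, 0 ≤ C ∧ ∀ N : ℕ, 1 ≤ N → ∀ Q : ℝ, Q ≤ N →
      ∃ P : Finset ℕ, (∀ p ∈ P, p.Prime ∧ p ≠ 2 ∧ (p : ℝ) ≤ Q) ∧
        Q ≤ C * (N : ℝ) ^ ε * (P.card + 1) := by
  refine ⟨16 + 4 / ε, by positivity, fun N hN Q hQN => ⟨(Nat.primesLE ⌊Q⌋₊).erase 2, ?_, ?_⟩⟩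
  · intro p hp
    obtain ⟨hp2, hp⟩ := Finset.mem_erase.mp hp
    obtain ⟨hpQ, hp⟩ := Nat.mem_primesLE.mp hp
    exact ⟨hp, hp2, (Nat.le_floor_iff' hp.ne_zero).mp hpQ⟩
  have hN1 : 1 ≤ (N : ℝ) ^ ε := Real.one_le_rpow (by exact_mod_cast hN) hε.le
  obtain hQ | hQ := lt_or_ge Q 16
  · calc Q ≤ 16 * 1 * 1 := by linarith
      _ ≤ _ := by
        gcongr
        · exact le_add_of_nonneg_right (by positivity)
        · exact le_add_of_nonneg_left (by positivity)
  · have hcard : (Nat.primeCounting ⌊Q⌋₊ : ℝ) ≤ ((Nat.primesLE ⌊Q⌋₊).erase 2).card + 1 := by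
      rw [← Nat.primesLE_card_eq_primeCounting]
      exact_mod_cast Nat.sub_le_iff_le_add.mp Finset.pred_card_le_card_erase
    have hlog : Real.log Q ≤ (N : ℝ) ^ ε / ε :=
      (Real.log_le_rpow_div (by linarith) hε).trans (by gcongr)
    calc Q ≤ 4 * (Nat.primeCounting ⌊Q⌋₊ * Real.log Q) := by
          linarith [div_four_le_primeCounting_mul_log hQ]
      _ ≤ 4 * ((((Nat.primesLE ⌊Q⌋₊).erase 2).card + 1) * ((N : ℝ) ^ ε / ε)) := by
        gcongr
        exact Real.log_nonneg (by linarith)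
      _ = 4 / ε * (N : ℝ) ^ ε * (((Nat.primesLE ⌊Q⌋₊).erase 2).card + 1) := by ring
      _ ≤ _ := by
        gcongr
        linarith

theorem mem_largeSquareDivisorPairs {N : ℕ} {w : ℤ × ℤ} :
    w ∈ largeSquareDivisorPairs f N ↔
      w ∈ coprimeBox N ∧ ∃ p : ℕ, p.Prime ∧ N < p ∧ (p : ℤ) ^ 2 ∣ formValue f w := by
  simp only [largeSquareDivisorPairs, Set.mem_ofPred_eq, mem_coprimeBox,
    Int.isCoprime_iff_gcd_eq_one, and_assoc]
  rfl

theorem exists_squarefree_mul_sq_eq_of_sq_dvd {m : ℤ} (hm : m ≠ 0) {B L : ℝ} (hB : |(m : ℝ)| ≤ B)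
    (hL : 0 < L) {p : ℕ} (hLp : L < p) (h : (p : ℤ) ^ 2 ∣ m) :
    ∃ d t : ℤ, Squarefree d ∧ |(d : ℝ)| ≤ B / L ^ 2 ∧ m = d * t ^ 2 := by
  obtain ⟨k, rfl⟩ := h
  obtain ⟨d, t, hd, rfl⟩ := exists_squarefree_mul_sq_eq k
  refine ⟨d, p * t, hd, ?_, by ring⟩
  have ht : (1 : ℝ) ≤ |(t : ℝ)| := by
    exact_mod_cast Int.one_le_abs (z := t) (by rintro rfl; simp at hm)
  rw [le_div_iff₀ (by positivity)]
  calc |(d : ℝ)| * L ^ 2 ≤ |(d : ℝ)| * p ^ 2 * |(t : ℝ)| ^ 2 := by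
        refine (show |(d : ℝ)| * L ^ 2 ≤ |(d : ℝ)| * p ^ 2 by gcongr).trans ?_
        exact le_mul_of_one_le_right (by positivity) (one_le_pow₀ ht)
    _ = |(((p : ℤ) ^ 2 * (d * t ^ 2) : ℤ) : ℝ)| := by
        push_cast
        rw [abs_mul, abs_mul, abs_pow, abs_pow, Nat.abs_cast]
        ring
    _ ≤ B := hB

open Classical in
theorem largeSquareDivisorCount_le_add (f : MvPolynomial (Fin 2) ℤ) (N : ℕ) (L : ℝ) :
    largeSquareDivisorCount f N ≤
      Set.ncard {w ∈ (coprimeBox N : Set (ℤ × ℤ)) |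
        ∃ p : ℕ, p.Prime ∧ N < p ∧ p ≤ ⌊L⌋₊ ∧ (p : ℤ) ^ 2 ∣ formValue f w} +
      {w ∈ coprimeBox N | ∃ p : ℕ, L < p ∧ (p : ℤ) ^ 2 ∣ formValue f w}.card := by
  rw [← Set.ncard_coe_finset]
  refine (Set.ncard_le_ncard (fun w hw => ?_) (Set.Finite.union
    ((coprimeBox N).finite_toSet.subset (Set.sep_subset _ _)) (Finset.finite_toSet _))).trans
    (Set.ncard_union_le _ _)
  obtain ⟨hwN, p, hp, hNp, hdvd⟩ := mem_largeSquareDivisorPairs.mp hw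
  obtain hpL | hLp := le_or_gt (p : ℝ) L
  · exact Or.inl ⟨hwN, p, hp, hNp, Nat.le_floor hpL, hdvd⟩
  · exact Or.inr (Finset.mem_coe.mpr (Finset.mem_filter.mpr ⟨hwN, p, hLp, hdvd⟩))

theorem sqrt_mul_div_sq {a b c : ℝ} (ha : 0 ≤ a) (hb : 0 ≤ b) (hc : 0 ≤ c) :
    √(a * b / c ^ 2) = √a * (√b / c) := by
  rw [Real.sqrt_div (mul_nonneg ha hb), Real.sqrt_mul ha, Real.sqrt_sq hc, mul_div_assoc]

open Classical in
theorem exists_card_filter_lt_sq_dvd_le (hf : f.IsHomogeneous n) (hn : Odd n)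
    (hf0 : IsAnisotropic f) {ε : ℝ} (hε : 0 < ε) :
    ∃ C : ℝ, 0 ≤ C ∧ ∀ N : ℕ, 1 ≤ N → ∀ Q L : ℝ, 0 < Q → Q ≤ N → 0 < L →
      ({w ∈ coprimeBox N | ∃ p : ℕ, L < p ∧ (p : ℤ) ^ 2 ∣ formValue f w}.card : ℝ) ≤
        C * (N : ℝ) ^ ε * (N ^ 2 / Q + Q ^ 2 * N * √(N ^ n) / L) := by
  obtain ⟨H, hH1, hH⟩ := exists_abs_formValue_le_on_coprimeBox hf
  obtain ⟨C₁, hC₁0, hC₁⟩ := exists_card_le_of_squarefree_mul_sq hf hn hf0 (half_pos hε)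
  obtain ⟨C₂, hC₂0, hC₂⟩ := exists_finset_odd_primes (half_pos hε)
  refine ⟨C₁ * (C₂ + √H), by positivity, fun N hN Q L hQ0 hQN hL => ?_⟩
  have hN1 : 1 ≤ (N : ℝ) ^ (ε / 2) := Real.one_le_rpow (by exact_mod_cast hN) (half_pos hε).le
  obtain ⟨P, hP, hPQ⟩ := hC₂ N hN Q hQN
  have hcard := hC₁ N hN P Q (H * N ^ n / L ^ 2) hP
      {w ∈ coprimeBox N | ∃ p : ℕ, L < p ∧ (p : ℤ) ^ 2 ∣ formValue f w}
      (Finset.filter_subset _ _) fun w hw => by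
    obtain ⟨hwN, p, hLp, hdvd⟩ := Finset.mem_filter.mp hw
    exact exists_squarefree_mul_sq_eq_of_sq_dvd
      (hf0 w (ne_zero_of_isCoprime (mem_coprimeBox.mp hwN).2.2)) (hH N w hwN) hL hLp hdvd
  have hdiv : (N : ℝ) ^ 2 / (P.card + 1) ≤ C₂ * (N : ℝ) ^ (ε / 2) * (N ^ 2 / Q) := by
    rw [mul_div_assoc', div_le_div_iff₀ (by positivity) hQ0]
    calc (N : ℝ) ^ 2 * Q ≤ N ^ 2 * (C₂ * (N : ℝ) ^ (ε / 2) * (P.card + 1)) := by gcongr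
      _ = _ := by ring
  have hroot : Q ^ 2 * N * √(H * N ^ n / L ^ 2) ≤
      √H * (N : ℝ) ^ (ε / 2) * (Q ^ 2 * N * √(N ^ n) / L) := by
    rw [sqrt_mul_div_sq (by positivity) (by positivity) hL.le]
    calc _ = √H * 1 * (Q ^ 2 * N * √(N ^ n) / L) := by ring
      _ ≤ _ := by gcongr
  set X := (N : ℝ) ^ 2 / Q
  set Y := Q ^ 2 * N * √(N ^ n) / L
  have : 0 ≤ X := by positivity
  have : 0 ≤ Y := by positivity
  calc _ ≤ C₁ * (N : ℝ) ^ (ε / 2) *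
        (N ^ 2 / (P.card + 1) + Q ^ 2 * N * √(H * N ^ n / L ^ 2)) := hcard
    _ ≤ C₁ * (N : ℝ) ^ (ε / 2) * ((C₂ + √H) * (N : ℝ) ^ (ε / 2) * X +
          (C₂ + √H) * (N : ℝ) ^ (ε / 2) * Y) := by
        gcongr _ * (?_ + ?_)
        · exact hdiv.trans (by gcongr; linarith [Real.sqrt_nonneg H])
        · exact hroot.trans (by gcongr; linarith)
    _ = C₁ * (C₂ + √H) * ((N : ℝ) ^ (ε / 2) * (N : ℝ) ^ (ε / 2)) * (X + Y) := by ring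
    _ = C₁ * (C₂ + √H) * (N : ℝ) ^ ε * (X + Y) := by
        rw [← Real.rpow_add (by exact_mod_cast hN), add_halves]

theorem exists_largeSquareDivisorCount_le (hf : f.IsHomogeneous n) (hn : Odd n)
    (hsq : Squarefree (MvPolynomial.map (Int.castRingHom ℚ) f)) (hf0 : IsAnisotropic f) {ε : ℝ}
    (hε : 0 < ε) :
    ∃ C : ℝ, 0 ≤ C ∧ ∀ N : ℕ, 1 ≤ N → ∀ Q L : ℝ, 0 < Q → Q ≤ N → 0 < L →
      (largeSquareDivisorCount f N : ℝ) ≤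
        C * (N : ℝ) ^ ε * (L + N ^ 2 / Q + Q ^ 2 * N * √(N ^ n) / L) := by
  classical
  obtain ⟨K, hK⟩ := exists_card_filter_exists_prime_le hf hn.pos.ne' hf0 hsq
  obtain ⟨C, hC0, hC⟩ := exists_card_filter_lt_sq_dvd_le hf hn hf0 hε
  refine ⟨K + C, by positivity, fun N hN Q L hQ0 hQN hL => ?_⟩
  have hN1 : 1 ≤ (N : ℝ) ^ ε := Real.one_le_rpow (by exact_mod_cast hN) hε.le
  have hlarge := hC N hN Q L hQ0 hQN hL
  rw [add_assoc]
  set X := (N : ℝ) ^ 2 / Q + Q ^ 2 * N * √(N ^ n) / L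
  have hX0 : 0 ≤ X := by positivity
  calc (largeSquareDivisorCount f N : ℝ) ≤ (K * ⌊L⌋₊ : ℕ) +
        {w ∈ coprimeBox N | ∃ p : ℕ, L < p ∧ (p : ℤ) ^ 2 ∣ formValue f w}.card := by
        exact_mod_cast (largeSquareDivisorCount_le_add f N L).trans
          (Nat.add_le_add_right (hK N ⌊L⌋₊) _)
    _ ≤ K * (N : ℝ) ^ ε * L + C * (N : ℝ) ^ ε * X := by
        rw [Nat.cast_mul]
        gcongr
        · exact le_mul_of_one_le_right K.cast_nonneg hN1
        · exact Nat.floor_le hL.le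
    _ ≤ K * (N : ℝ) ^ ε * (L + X) + C * (N : ℝ) ^ ε * (L + X) := by
        gcongr <;> linarith
    _ = (K + C) * (N : ℝ) ^ ε * (L + X) := by ring

end LargeSquareDivisors

theorem mainTheorem12_general {n : ℕ} (hn : Odd n) (f : MvPolynomial (Fin 2) ℤ)
    (hf : f.IsHomogeneous n) (hsq : Squarefree (MvPolynomial.map (Int.castRingHom ℚ) f))
    (hf0 : IsAnisotropic f) (ε : ℝ) (hε : 0 < ε) :
    ∃ C : ℝ, ∀ N : ℕ, 1 ≤ N →
      (largeSquareDivisorCount f N : ℝ) ≤ C * (N : ℝ) ^ (((10 + n : ℝ) / 8) + ε) := by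
  obtain ⟨C, -, hC⟩ := exists_largeSquareDivisorCount_le hf hn hsq hf0 hε
  refine ⟨3 * C, fun N hN => ?_⟩
  have hN0 : (0 : ℝ) < N := by exact_mod_cast hN
  have hQN : (N : ℝ) ^ ((6 - n : ℝ) / 8) ≤ N := by
    refine Real.rpow_le_self_of_one_le (by exact_mod_cast hN) ?_
    linarith [n.cast_nonneg (α := ℝ)]
  have hsecond : (N : ℝ) ^ 2 / (N : ℝ) ^ ((6 - n : ℝ) / 8) = (N : ℝ) ^ ((10 + n : ℝ) / 8) := by
    rw [← Real.rpow_natCast, ← Real.rpow_sub hN0]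
    ring_nf
  have hthird : ((N : ℝ) ^ ((6 - n : ℝ) / 8)) ^ 2 * N * √(N ^ n) / (N : ℝ) ^ ((10 + n : ℝ) / 8) =
      (N : ℝ) ^ ((10 + n : ℝ) / 8) := by
    rw [Real.sqrt_eq_rpow, ← Real.rpow_natCast, ← Real.rpow_natCast, ← Real.rpow_mul hN0.le,
      ← Real.rpow_mul hN0.le, ← Real.rpow_add_one hN0.ne', ← Real.rpow_add hN0,
      ← Real.rpow_sub hN0]
    ring_nf
  calc (largeSquareDivisorCount f N : ℝ) ≤ _ :=
        hC N hN _ ((N : ℝ) ^ ((10 + n : ℝ) / 8)) (by positivity) hQN (by positivity)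
    _ = 3 * C * (N : ℝ) ^ (((10 + n : ℝ) / 8) + ε) := by
        rw [hsecond, hthird, Real.rpow_add hN0]
        ring

theorem mainTheorem12 (f : MvPolynomial (Fin 2) ℤ) (hf : f.IsHomogeneous 5)
    (hirr : Irreducible (MvPolynomial.map (Int.castRingHom ℚ) f)) (ε : ℝ) (hε : 0 < ε) :
    ∃ C : ℝ, ∀ N : ℕ, 1 ≤ N →
      (largeSquareDivisorCount f N : ℝ) ≤ C * (N : ℝ) ^ ((5 + Real.sqrt 113) / 8 + ε) := by
  obtain ⟨C, hC⟩ := mainTheorem12_general (by decide) f hf hirr.squarefree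
    (isAnisotropic_of_irreducible hf (by norm_num) hirr) ε hε
  have hC0 : 0 ≤ C := by simpa using (Nat.cast_nonneg _).trans (hC 1 le_rfl)
  refine ⟨C, fun N hN => (hC N hN).trans ?_⟩
  gcongr C * _ ^ (?_ / 8 + ε)
  · exact_mod_cast hN
  · rw [show (10 + (5 : ℕ) : ℝ) = 5 + 10 by norm_num]
    gcongr
    exact Real.le_sqrt_of_sq_le (by norm_num)
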